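/- Consider the Bernoulli growth random walk (BGRW) with parameter $p\in(0,1]$: the Markov chain $(T_t,X_t)_{t\ge 0}$ whose states are pairs $(T,x)$, where $T$ is a locally finite tree with $V(T)\subset\mathbb{N}$ and $\mathbb{N}\setminus V(T)$ infinite, and $x\in V(T)$. From the state $(T,x)$ the next state $(T',x')$ is sampled as follows. With probability $p$, $T'$ is obtained from $T$ by adding the new vertex $m=\min(\mathbb{N}\setminus V(T))$ and the edge $\{x,m\}$; otherwise $T'=T$. Then $x'$ is a uniformly chosen neighbour of $x$ in $T'$ (with the convention $x'=x$ if $x$ has no neighbour in $T'$, which can happen only if $T'=T$ has a single vertex). Let $\mathbb{P}_{T_0,x_0,p}$ be the law of the chain started from $(T_0,x_0)$. For a vertex $y$ let $$v(y):=|\{0\le t<+\infty : X_t=y\}|\in\mathbb{N}\cup\{+\infty\}$$ be the total number of visits to $y$. **Lemma.** For every $p_0\in(0,1]$ there exist constants $C,\beta>0$, depending only on $p_0$, such that for all $p\in[p_0,1]$, all initial states $(T_0,x_0)$ and all $y\in V(T_0)$, $$\forall k\ge 0:\quad \mathbb{P}_{T_0,x_0,p}(v(y)\ge k)\le C\,e^{-\beta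 k}$$ and $$\mathbb{P}_{T_0,x_0,p}(v(y)>0)\le C\,e^{-\beta\,\mathrm{dist}_{T_0}(x_0,y)}.$$ In particular (taking $p_0=p$), for each fixed $p\in(0,1]$ both bounds hold with constants that depend only on $p$. -/

import Mathlib

open MeasureTheory ProbabilityTheory

noncomputable section

namespace BGRW

/-- A state of the walk: a locally finite tree `T` whose vertices are natural numbers, with
infinitely many natural numbers left unused, together with a vertex of `T`. -/
@[ext]
structure State where
  /-- The tree, as a graph whose vertex set is a subset of `ℕ`. -/
  tree : (⊤ : SimpleGraph ℕ).Subgraph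
  /-- The position of the walker. -/
  pos : ℕ
  connected : tree.Connected
  acyclic : tree.spanningCoe.IsAcyclic
  finite_neighborSet : ∀ v, (tree.neighborSet v).Finite
  infinite_compl : tree.vertsᶜ.Infinite
  pos_mem : pos ∈ tree.verts

namespace State

variable (s : State)

/-- Graph distance in the tree of the state `s`. -/
def dist (x y : ℕ) : ℕ := s.tree.spanningCoe.dist x y

/-- The least natural number that is not a vertex of the tree. -/
def fresh : ℕ := sInf s.tree.vertsᶜ

theorem fresh_notMem : s.fresh ∉ s.tree.verts := Nat.sInf_mem s.infinite_compl.nonempty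

theorem pos_ne_fresh : s.pos ≠ s.fresh := fun h => s.fresh_notMem (h ▸ s.pos_mem)

/-- The tree of `s` with a new vertex `s.fresh`, joined by an edge to the walker's position. -/
def grownTree : (⊤ : SimpleGraph ℕ).Subgraph :=
  s.tree ⊔ (⊤ : SimpleGraph ℕ).subgraphOfAdj (v := s.pos) (w := s.fresh) s.pos_ne_fresh

theorem grownTree_acyclic : s.grownTree.spanningCoe.IsAcyclic := by
  have h : s.grownTree.spanningCoe = s.tree.spanningCoe ⊔ SimpleGraph.edge s.pos s.fresh := by
    ext a b
    have := s.pos_ne_fresh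
    simp only [grownTree, SimpleGraph.Subgraph.spanningCoe_adj, SimpleGraph.Subgraph.sup_adj,
      SimpleGraph.subgraphOfAdj_adj, SimpleGraph.sup_adj, SimpleGraph.edge_adj, Sym2.eq_iff]
    grind
  rw [h]
  refine s.acyclic.sup_edge_of_not_reachable ?_
  rintro ⟨w⟩
  have hn : ¬ w.reverse.Nil := SimpleGraph.Walk.not_nil_of_ne s.pos_ne_fresh.symm
  exact s.fresh_notMem (s.tree.edge_vert (w.reverse.adj_snd hn))

/-- Add a new leaf at the walker's position, without moving the walker. -/
def grow : State where
  tree := s.grownTree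
  pos := s.pos
  connected := SimpleGraph.Subgraph.connected_sup s.connected.preconnected
    (SimpleGraph.Subgraph.subgraphOfAdj_connected _).preconnected ⟨s.pos, s.pos_mem, by simp⟩
  acyclic := s.grownTree_acyclic
  finite_neighborSet v := by
    rw [grownTree, SimpleGraph.Subgraph.neighborSet_sup]
    refine (s.finite_neighborSet v).union (Set.Finite.subset (Set.toFinite {s.pos, s.fresh}) ?_)
    exact SimpleGraph.neighborSet_subgraphOfAdj_subset _
  infinite_compl := by
    refine (s.infinite_compl.sdiff (Set.toFinite {s.pos, s.fresh})).mono ?_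
    rintro v ⟨hv, hv'⟩ (h | h)
    · exact hv h
    · exact hv' h
  pos_mem := Or.inl s.pos_mem

/-- Move the walker to a given neighbour of its position, without changing the tree. -/
def moveTo (v : s.tree.neighborSet s.pos) : State :=
  { s with
    pos := v
    pos_mem := (s.tree.mem_neighborSet _ _ |>.1 v.2).snd_mem }

/-- The law of the state after the walker jumps to a uniformly chosen neighbour of its position.
If the position has no neighbour (the tree is a single vertex) then the walker stays put. -/
def jump : PMF State :=
  open Classical in
  if h : (s.tree.neighborSet s.pos).Nonempty then
    haveI := h.to_subtype
    haveI := (s.finite_neighborSet s.pos).fintype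
    (PMF.uniformOfFintype (s.tree.neighborSet s.pos)).map s.moveTo
  else PMF.pure s

end State

/- Each one-step law has finite support, so it is a measure on all subsets of the state space;
the set of states carries the discrete σ-algebra. -/
instance : MeasurableSpace State := ⊤

/-- The law of the state after one step: with probability `p` a new leaf is added at the walker's
position, and then the walker jumps to a uniformly chosen neighbour in the resulting tree. -/
def step (p : unitInterval) (s : State) : Measure State :=
  ENNReal.ofReal (p : ℝ) • s.grow.jump.toMeasure + ENNReal.ofReal (1 - (p : ℝ)) • s.jump.toMeasure

instance (p : unitInterval) (s : State) : IsProbabilityMeasure (step p s) where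
  measure_univ := by
    simp [step, ← ENNReal.ofReal_add p.2.1 (sub_nonneg.2 p.2.2)]

/-- The transition kernel of the walk. -/
def kernel (p : unitInterval) : Kernel State State where
  toFun := step p
  measurable' := measurable_from_top

instance (p : unitInterval) : IsMarkovKernel (kernel p) :=
  ⟨fun s => inferInstanceAs (IsProbabilityMeasure (step p s))⟩

/-- The law, on the space of trajectories, of the Markov chain with transition kernel `kernel p`
and initial state `s`. -/
def law (p : unitInterval) (s : State) : Measure (ℕ → State) :=
  Kernel.traj (X := fun _ => State)
    (fun n => (kernel p).comap (fun h : (_ : Finset.Iic n) → State =>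
      h ⟨n, Finset.mem_Iic.2 le_rfl⟩) (measurable_pi_apply _)) 0 (fun _ => s)

instance (p : unitInterval) (s : State) : IsProbabilityMeasure (law p s) := by
  unfold law; infer_instance

/-- The total number of visits of the walker to `y` along the trajectory `ω` (possibly `∞`). -/
def visits (y : ℕ) (ω : ℕ → State) : ℕ∞ := {t : ℕ | (ω t).pos = y}.encard

end BGRW

end

noncomputable section

namespace BGRW

/-! ### A fair gambler -/

/-! The heart is a uniform escape estimate: for some `q < 1` depending only on `p₀`, a walker that
has just stepped onto a new leaf returns to the neighbour of that leaf with probability at most `q`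
(`exists_hit_fresh_le`). It follows that any given neighbour of the current position is ever hit
with probability at most some `r < 1` (`hit_le_of_adj`). In a tree, reaching a vertex at distance
`d` forces `d` such crossings, hence the bound `r ^ d` (`hit_le_pow`). Each visit is the last with
probability at least `p * (1 - r)`, so the number of visits has a geometric tail (`visitProb_le`).

For the escape estimate, consider one vertex and its children. At each departure the parent and any
given child are equally likely, so exits to the parent and visits to that child form a sequence of
fair coin tosses. Allow `M` exits from a new vertex. The first of them make it likely that there are
56 children. Each of these then receives `M` visits before the remaining exits with probability at
least 1/14, because a fair gambler overcomes a fixed deficit with such a chance if the game is long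
(`exists_win_ge`). Suppose that `M` excursions into a new child all return with probability at most
`1 - δ`. Four children on average receive `M` visits, so the parent's own `M` excursions all return
with probability at most about `1 - 2δ`. The chance that too few children are born costs half of
this gain, which leaves `1 - δ` again (`exists_counterUrn_le`). The bound therefore passes from
depth `h` to depth `h + 1` with the same `δ` (`exists_excursion_leaf_le`).

Time, depth and numbers of departures are truncated, so that every probability is a finite
recursion; all bounds are uniform in the truncation. Excursions are functionals on abstract trees,
where independence of the subtrees is an algebraic identity (`loop_returns`); `hit_le_loop`
transfers the result to the walk, and `law_visits_le` to the trajectory measure. -/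

/-- The probability that a fair coin shows `j` heads before it shows `m` tails. -/
def win : ℕ → ℕ → ℝ
  | 0, _ => 1
  | _ + 1, 0 => 0
  | j + 1, m + 1 => (win j (m + 1) + win (j + 1) m) / 2

theorem win_zero (m : ℕ) : win 0 m = 1 := by simp [win]

theorem win_nonneg_le_one (j m : ℕ) : 0 ≤ win j m ∧ win j m ≤ 1 := by
  fun_induction win j m with
  | case1 => norm_num
  | case2 => norm_num
  | case3 j m h1 h2 => constructor <;> linarith [h1.1, h1.2, h2.1, h2.2]

theorem win_nonneg (j m : ℕ) : 0 ≤ win j m := (win_nonneg_le_one j m).1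

theorem win_le_one (j m : ℕ) : win j m ≤ 1 := (win_nonneg_le_one j m).2

theorem win_mono_right (j m : ℕ) : win j m ≤ win j (m + 1) := by
  induction j generalizing m with
  | zero => simp [win]
  | succ j ihj =>
    induction m with
    | zero => simpa [win] using win_nonneg (j + 1) 1
    | succ m ihm =>
      have h1 : win (j + 1) (m + 1 + 1) = (win j (m + 1 + 1) + win (j + 1) (m + 1)) / 2 := by
        rw [win]
      have h2 : win (j + 1) (m + 1) = (win j (m + 1) + win (j + 1) m) / 2 := by rw [win]
      linarith [ihj (m + 1)]

theorem win_succ_le (j m : ℕ) : win (j + 1) m ≤ win j m := by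
  cases m with
  | zero => simpa [win] using win_nonneg j 0
  | succ m =>
    have h1 : win (j + 1) (m + 1) = (win j (m + 1) + win (j + 1) m) / 2 := by rw [win]
    linarith [win_mono_right (j + 1) m]

theorem win_anti_left (m : ℕ) : Antitone fun j => win j m :=
  antitone_nat_of_succ_le fun j => win_succ_le j m

/-- `win (M - n) m` is harmonic for the walk that raises `n` or lowers `m` with equal chance. -/
theorem win_sub_harmonic (M n m : ℕ) :
    win (M - (n + 1)) (m + 1) + win (M - n) m = 2 * win (M - n) (m + 1) := by
  rcases h : M - n with _ | j
  · rw [show M - (n + 1) = 0 by omega]; simp [win]; norm_num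
  · rw [show M - (n + 1) = j by omega, win]; ring

/-- The probability that a simple random walk started at `d` is positive at time `T`. -/
def walkPos : ℕ → ℤ → ℝ
  | 0, d => if 0 < d then 1 else 0
  | T + 1, d => (walkPos T (d + 1) + walkPos T (d - 1)) / 2

theorem walkPos_le_one (T : ℕ) (d : ℤ) : walkPos T d ≤ 1 := by
  induction T generalizing d with
  | zero => rw [walkPos]; split <;> norm_num
  | succ T ih => rw [walkPos]; linarith [ih (d + 1), ih (d - 1)]

theorem walkPos_eq_zero (T : ℕ) (d : ℤ) (h : d + T ≤ 0) : walkPos T d = 0 := by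
  induction T generalizing d with
  | zero => rw [walkPos, if_neg]; simp at h; omega
  | succ T ih =>
    push_cast at h
    rw [walkPos, ih _ (by omega), ih _ (by omega)]; norm_num

/-- If `m + j ≥ 1`, then `m + j - 1` tosses produce either `j` heads or `m` tails but not both, and
the heads win exactly when `m - j` plus the excess of heads is positive. -/
theorem walkPos_le_win (j m : ℕ) : walkPos (m + j - 1) ((m : ℤ) - j) ≤ win j m := by
  fun_induction win j m with
  | case1 => exact walkPos_le_one _ _
  | case2 j => rw [walkPos_eq_zero]; push_cast; omega
  | case3 j m h1 h2 =>
    rw [show m + 1 + (j + 1) - 1 = (m + j) + 1 by omega, walkPos]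
    rw [show m + 1 + j - 1 = m + j by omega] at h1
    rw [show m + (j + 1) - 1 = m + j by omega] at h2
    have e1 : ((m + 1 : ℕ) : ℤ) - ((j + 1 : ℕ) : ℤ) + 1 = ((m + 1 : ℕ) : ℤ) - j := by
      push_cast; ring
    have e2 : ((m + 1 : ℕ) : ℤ) - ((j + 1 : ℕ) : ℤ) - 1 = (m : ℤ) - ((j + 1 : ℕ) : ℤ) := by
      push_cast; ring
    rw [e1, e2]; linarith

/-- Together with `quartic_nonpos` this bounds the quartic by `7` times the indicator of `x > 0`.
Its mean along a random walk involves only moments, so it yields a lower bound on the probability of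
being positive. -/
theorem quartic_le (x : ℝ) : 4 / 3 * x + x ^ 2 - x ^ 4 / 12 ≤ 7 := by
  nlinarith [sq_nonneg (x ^ 2 - 31 / 4), sq_nonneg (x - 11 / 4)]

theorem quartic_nonpos {x : ℝ} (hx : x ≤ 0) : 4 / 3 * x + x ^ 2 - x ^ 4 / 12 ≤ 0 := by
  have : 4 / 3 * x + x ^ 2 - x ^ 4 / 12 = x * ((x + 2) ^ 2 * (4 - x)) / 12 := by ring
  rw [this]
  have : 0 ≤ (x + 2) ^ 2 * (4 - x) := by have := sq_nonneg (x + 2); nlinarith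
  nlinarith

/-- The left side is the mean of the quartic at `b` times the position at time `T`; the second and
fourth moments of the position satisfy the one-step recursion exactly. -/
theorem le_walkPos {b : ℝ} (hb : 0 ≤ b) (T : ℕ) (d : ℤ) :
    4 / 3 * (b * d) + b ^ 2 * ((d : ℝ) ^ 2 + T) -
      b ^ 4 * ((d : ℝ) ^ 4 + 6 * (d : ℝ) ^ 2 * T + 3 * (T : ℝ) ^ 2 - 2 * T) / 12
      ≤ 7 * walkPos T d := by
  induction T generalizing d with
  | zero =>
    rw [walkPos]
    split_ifs with h
    · have := quartic_le (b * d)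
      simp; nlinarith
    · have : (d : ℝ) ≤ 0 := by exact_mod_cast not_lt.1 h
      have := quartic_nonpos (mul_nonpos_of_nonneg_of_nonpos hb this)
      simp; nlinarith
  | succ T ih =>
    rw [walkPos]
    have h1 := ih (d + 1)
    have h2 := ih (d - 1)
    push_cast at h1 h2 ⊢
    linarith

/-- A gambler who needs `L` more heads than tails still has a chance bounded away from `0`, if
enough rounds remain. -/
theorem exists_win_ge (l : ℕ) : ∃ m, 1 / 14 ≤ win (m + (2 * l + 1)) m := by
  -- The number of tosses will be exactly `(2 * s) ^ 2`, with standard deviation `2 * s`, of which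
  -- the deficit `2 * l + 1` is one sixteenth.
  set s : ℕ := 8 * (2 * l + 1) with hs
  have hls : l ≤ 2 * s ^ 2 := by nlinarith
  refine ⟨2 * s ^ 2 - l, le_trans ?_ (walkPos_le_win _ _)⟩
  have h1 : 2 * s ^ 2 - l + (2 * s ^ 2 - l + (2 * l + 1)) - 1 = (2 * s) ^ 2 := by
    have : (2 * s) ^ 2 = 4 * s ^ 2 := by ring
    rw [this]; omega
  have h2 : ((2 * s ^ 2 - l : ℕ) : ℤ) - ((2 * s ^ 2 - l + (2 * l + 1) : ℕ) : ℤ)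
      = -(2 * l + 1) := by push_cast; ring
  rw [h1, h2]
  have hpos : (0 : ℝ) < 2 * l + 1 := by positivity
  have h3 := le_walkPos (b := 1 / (2 * s)) (by positivity) ((2 * s) ^ 2) (-(2 * l + 1))
  have hsr : (s : ℝ) = 8 * (2 * l + 1) := by rw [hs]; push_cast; ring
  rw [hsr] at h3
  push_cast at h3
  rw [hsr] at h3
  have h4 : (2 * (8 * (2 * (l : ℝ) + 1))) = 16 * (2 * l + 1) := by ring
  rw [h4] at h3
  generalize hw : walkPos _ _ = w at h3 ⊢
  generalize hx : (2 * (l : ℝ) + 1) = x at h3 hpos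
  have h5 : 4 / 3 * (1 / (16 * x) * -x) + (1 / (16 * x)) ^ 2 * ((-x) ^ 2 + (16 * x) ^ 2) -
      (1 / (16 * x)) ^ 4 * ((-x) ^ 4 + 6 * (-x) ^ 2 * (16 * x) ^ 2 + 3 * ((16 * x) ^ 2) ^ 2
      - 2 * (16 * x) ^ 2) / 12 = 4 / 3 * (-1 / 16) + (1 / 256 + 1)
      - (1 / 65536 + 6 / 256 + 3) / 12 + (1 / (16 * x)) ^ 2 / 6 := by
    field_simp; ring
  rw [h5] at h3
  have : 0 ≤ (1 / (16 * x)) ^ 2 := by positivity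
  linarith

/-! ### The urn at one vertex -/

section Urn

variable {α : Type*}

/-- Mean over the parent and the `k` children of a vertex. -/
def jumpMean (exit : ℕ → (ℕ → α) → ℝ) (visit : ℕ → (ℕ → α) → ℕ → ℝ) (k : ℕ) (c : ℕ → α) : ℝ :=
  (exit k c + ∑ i ∈ Finset.range k, visit k c i) / (k + 1)

/-- One departure from a vertex with `k` children carrying the data `c`: with probability `p` a
child carrying `new` is added, then the walk exits to the parent or visits a child. -/
def urnStep (p : ℝ) (new : α) (exit : ℕ → (ℕ → α) → ℝ) (visit : ℕ → (ℕ → α) → ℕ → ℝ)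
    (k : ℕ) (c : ℕ → α) : ℝ :=
  (1 - p) * jumpMean exit visit k c + p * jumpMean exit visit (k + 1) (Function.update c k new)

theorem jumpMean_le {exit : ℕ → (ℕ → α) → ℝ} {visit : ℕ → (ℕ → α) → ℕ → ℝ} {k : ℕ} {c : ℕ → α}
    {b : ℝ} (he : exit k c ≤ b) (hv : ∀ i < k, visit k c i ≤ b) : jumpMean exit visit k c ≤ b := by
  rw [jumpMean, div_le_iff₀ (by positivity)]
  have := Finset.sum_le_card_nsmul (Finset.range k) (visit k c) b
    (fun i hi => hv i (Finset.mem_range.1 hi))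
  simp at this; linarith

theorem jumpMean_mono {β : Type*} {exit : ℕ → (ℕ → α) → ℝ} {visit : ℕ → (ℕ → α) → ℕ → ℝ}
    {exit' : ℕ → (ℕ → β) → ℝ} {visit' : ℕ → (ℕ → β) → ℕ → ℝ} {k : ℕ} {c : ℕ → α} {c' : ℕ → β}
    (he : exit k c ≤ exit' k c') (hv : ∀ i < k, visit k c i ≤ visit' k c' i) :
    jumpMean exit visit k c ≤ jumpMean exit' visit' k c' := by
  unfold jumpMean
  gcongr with i hi
  exact hv i (Finset.mem_range.1 hi)

end Urn

/-! ### Fair coins embedded in the urn -/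

/-- The urn with counters: `m` exits remain, `n` bounds the number of departures before the next
exit (with `N` for later ones), and `ν i` counts the visits to child `i`. At the end the payoff is
the product of `F` over the counters. -/
def counterUrn (p : ℝ) (F : ℕ → ℝ) (N : ℕ) : ℕ → ℕ → ℕ → (ℕ → ℕ) → ℝ
  | 0, _, k, ν => ∏ i ∈ Finset.range k, F (ν i)
  -- Exhausting the departures counts as an escape, so truncation only lowers the probability of
  -- returning.
  | _ + 1, 0, _, _ => 0
  | m + 1, n + 1, k, ν => urnStep p 0 (fun k ν => counterUrn p F N m N k ν)
      (fun k ν i => counterUrn p F N (m + 1) n k (Function.update ν i (ν i + 1))) k ν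
termination_by m n => (m, n)

section CounterUrn

variable {p : ℝ} {F : ℕ → ℝ} {N : ℕ}

theorem counterUrn_le_one (hp0 : 0 ≤ p) (hp1 : p ≤ 1) (hF0 : ∀ n, 0 ≤ F n) (hF1 : ∀ n, F n ≤ 1)
    (m n k : ℕ) (ν : ℕ → ℕ) : counterUrn p F N m n k ν ≤ 1 := by
  induction m generalizing n k ν with
  | zero => rw [counterUrn]; exact Finset.prod_le_one (fun i _ => hF0 _) (fun i _ => hF1 _)
  | succ m ihm =>
    induction n generalizing k ν with
    | zero => rw [counterUrn]; norm_num
    | succ n ihn =>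
      rw [counterUrn, urnStep]
      have h : ∀ k ν, jumpMean (fun k ν => counterUrn p F N m N k ν)
          (fun k ν i => counterUrn p F N (m + 1) n k (Function.update ν i (ν i + 1))) k ν ≤ 1 :=
        fun k ν => jumpMean_le (ihm _ _ _) fun i _ => ihn _ _
      nlinarith [h k ν, h (k + 1) (Function.update ν k 0)]

/-- The expected number, among the first `J` children, of counters that will reach `M`. -/
def reachSum (M J m : ℕ) (ν : ℕ → ℕ) : ℝ := ∑ i ∈ Finset.range J, win (M - ν i) m

theorem reachSum_le (M J m : ℕ) (ν : ℕ → ℕ) : reachSum M J m ν ≤ J := by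
  simpa [reachSum] using Finset.sum_le_card_nsmul (Finset.range J) (fun i => win (M - ν i) m) 1
    (fun i _ => win_le_one _ _)

theorem reachSum_nonneg (M J m : ℕ) (ν : ℕ → ℕ) : 0 ≤ reachSum M J m ν :=
  Finset.sum_nonneg fun _ _ => win_nonneg _ _

theorem reachSum_update (M J m : ℕ) (ν : ℕ → ℕ) (i : ℕ) :
    reachSum M J m (Function.update ν i (ν i + 1)) = reachSum M J m ν +
      if i < J then win (M - (ν i + 1)) m - win (M - ν i) m else 0 := by
  unfold reachSum
  split_ifs with h
  · have hi : i ∈ Finset.range J := Finset.mem_range.2 h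
    rw [← Finset.add_sum_erase _ _ hi, ← Finset.add_sum_erase _ (fun l => win (M - ν l) m) hi,
      Finset.sum_congr rfl (g := fun l => win (M - ν l) m)]
    · simp; ring
    · intro l hl; rw [Function.update_of_ne (Finset.ne_of_mem_erase hl)]
  · rw [add_zero]
    refine Finset.sum_congr rfl fun l hl => ?_
    rw [Function.update_of_ne]
    rintro rfl; exact h (Finset.mem_range.1 hl)

theorem reachSum_update_ge (M J m : ℕ) (ν : ℕ → ℕ) {k : ℕ} (hk : J ≤ k) (a : ℕ) :
    reachSum M J m (Function.update ν k a) = reachSum M J m ν := by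
  refine Finset.sum_congr rfl fun l hl => ?_
  rw [Function.update_of_ne]
  have := Finset.mem_range.1 hl; omega

/-- Departures to other children leave the term of child `i` unchanged, while an exit and a visit to
`i` are equally likely; `win_sub_harmonic` makes their effects cancel. -/
theorem reachSum_harmonic (M J m : ℕ) (ν : ℕ → ℕ) {k : ℕ} (hk : J ≤ k) :
    reachSum M J m ν + ∑ i ∈ Finset.range k,
      reachSum M J (m + 1) (Function.update ν i (ν i + 1)) =
      (k + 1) * reachSum M J (m + 1) ν := by
  simp_rw [reachSum_update, Finset.sum_add_distrib, ← Finset.sum_filter]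
  have : (Finset.range k).filter (· < J) = Finset.range J := by
    ext i; simp; omega
  rw [this]
  have h2 : reachSum M J m ν + ∑ i ∈ Finset.range J,
      (win (M - (ν i + 1)) (m + 1) - win (M - ν i) (m + 1)) = reachSum M J (m + 1) ν := by
    unfold reachSum
    rw [← Finset.sum_add_distrib]
    exact Finset.sum_congr rfl fun i _ => by linarith [win_sub_harmonic M (ν i) m]
  simp only [Finset.sum_const, Finset.card_range, nsmul_eq_mul]
  linarith

theorem prod_one_sub_le {ι : Type*} (s : Finset ι) (a : ι → ℝ) (h1 : ∑ i ∈ s, a i ≤ 1)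
    (h0 : ∀ i ∈ s, 0 ≤ a i) : ∏ i ∈ s, (1 - a i) ≤ 1 - (∑ i ∈ s, a i) / 2 := by
  have h0' : 0 ≤ ∑ i ∈ s, a i := Finset.sum_nonneg h0
  have : ∏ i ∈ s, (1 - a i) ≤ Real.exp (-∑ i ∈ s, a i) := by
    rw [← Finset.sum_neg_distrib, Real.exp_sum]
    refine Finset.prod_le_prod (fun i hi => ?_) fun i _ => ?_
    · linarith [Finset.single_le_sum h0 hi]
    · linarith [Real.add_one_le_exp (-a i)]
  refine this.trans ?_
  generalize ∑ i ∈ s, a i = x at h1 h0'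
  rw [Real.exp_neg]
  rw [inv_le_iff_one_le_mul₀ (Real.exp_pos _)]
  nlinarith [Real.add_one_le_exp x]

/-- The payoff `1 - δ` if the counter has reached `M`, and `1` otherwise. -/
def payoff (δ : ℝ) (M n : ℕ) : ℝ := 1 - δ * win (M - n) 0

theorem payoff_le_one {δ : ℝ} (h0 : 0 ≤ δ) (M n : ℕ) : payoff δ M n ≤ 1 := by
  have := mul_nonneg h0 (win_nonneg (M - n) 0)
  unfold payoff; linarith

theorem payoff_nonneg {δ : ℝ} (h1 : δ ≤ 1) (M n : ℕ) : 0 ≤ payoff δ M n := by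
  have := mul_le_mul h1 (win_le_one (M - n) 0) (win_nonneg _ _) zero_le_one
  unfold payoff; linarith

/-- After the last exit the product over the first `J` children is at most `1` minus `δ / 2` per
full counter, because `δ * J ≤ 1`. Harmonicity of `reachSum` carries this back to earlier times.
Factors of the other children are at most `1` and are dropped. -/
theorem counterUrn_le_reachSum {δ : ℝ} {M J : ℕ} (hp0 : 0 ≤ p) (hp1 : p ≤ 1) (hδ0 : 0 ≤ δ)
    (hδ1 : δ ≤ 1) (hδ : δ * J ≤ 1) (m n k : ℕ) (hk : J ≤ k) (ν : ℕ → ℕ) :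
    counterUrn p (payoff δ M) N m n k ν ≤ 1 - δ / 2 * reachSum M J m ν := by
  induction m generalizing n k ν with
  | zero =>
    rw [counterUrn]
    have h1 := reachSum_le M J 0 ν
    calc _ ≤ ∏ i ∈ Finset.range J, payoff δ M (ν i) := by
          rw [← Finset.prod_range_mul_prod_Ico _ hk]
          exact mul_le_of_le_one_right (Finset.prod_nonneg fun i _ => payoff_nonneg hδ1 _ _)
            (Finset.prod_le_one (fun i _ => payoff_nonneg hδ1 _ _)
              (fun i _ => payoff_le_one hδ0 _ _))
      _ ≤ 1 - (∑ i ∈ Finset.range J, δ * win (M - ν i) 0) / 2 := by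
          refine prod_one_sub_le _ _ ?_ fun i _ => mul_nonneg hδ0 (win_nonneg _ _)
          rw [← Finset.mul_sum]
          exact (mul_le_mul_of_nonneg_left h1 hδ0).trans hδ
      _ = _ := by rw [← Finset.mul_sum, reachSum]; ring
  | succ m ihm =>
    induction n generalizing k ν with
    | zero =>
      rw [counterUrn]
      nlinarith [reachSum_le M J (m + 1) ν, reachSum_nonneg M J (m + 1) ν]
    | succ n ihn =>
      rw [counterUrn, urnStep]
      have h : ∀ k ν, J ≤ k → jumpMean (fun k ν => counterUrn p (payoff δ M) N m N k ν)
          (fun k ν i => counterUrn p (payoff δ M) N (m + 1) n k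
            (Function.update ν i (ν i + 1))) k ν ≤ 1 - δ / 2 * reachSum M J (m + 1) ν := by
        intro k ν hk
        rw [jumpMean, div_le_iff₀ (by positivity)]
        have h1 := ihm N k hk ν
        have h2 := Finset.sum_le_sum fun i (_ : i ∈ Finset.range k) =>
          ihn k hk (Function.update ν i (ν i + 1))
        rw [Finset.sum_sub_distrib, ← Finset.mul_sum] at h2
        have h3 := reachSum_harmonic M J m ν hk
        simp at h2
        have h4 : δ / 2 * (reachSum M J m ν + ∑ i ∈ Finset.range k,
          reachSum M J (m + 1) (Function.update ν i (ν i + 1))) =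
          δ / 2 * ((k + 1) * reachSum M J (m + 1) ν) := by rw [h3]
        linarith
      have h1 := h k ν hk
      have h2 := h (k + 1) (Function.update ν k 0) (by omega)
      rw [reachSum_update_ge M J _ ν hk] at h2
      nlinarith

/-- A departure adds a child with probability `p ≥ p₀`, which multiplies the mean of `(1 / 2) ^ k`
by `1 - p / 2`. Each of the `l` extra exits requires at least one departure, and only that one is
counted. -/
theorem counterUrn_le_growth {p₀ θ A : ℝ} {m₀ : ℕ} (hp0 : 0 ≤ p₀) (hp : p₀ ≤ p) (hp1 : p ≤ 1)
    (hθ0 : 0 ≤ θ) (hθ1 : θ ≤ 1) (hA : 0 ≤ A)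
    (hbase : ∀ n k ν, counterUrn p F N m₀ n k ν ≤ 1 - θ * (1 - A * (1 / 2) ^ k))
    (l n k : ℕ) (ν : ℕ → ℕ) :
    counterUrn p F N (m₀ + l) n k ν ≤ 1 - θ * (1 - A * (1 / 2) ^ k * (1 - p₀ / 2) ^ l) := by
  have hl0 : 0 ≤ 1 - p₀ / 2 := by linarith
  induction l generalizing n k ν with
  | zero => simpa using hbase n k ν
  | succ l ihl =>
    induction n generalizing k ν with
    | zero =>
      rw [← add_assoc, counterUrn]
      have : 0 ≤ A * (1 / 2) ^ k * (1 - p₀ / 2) ^ (l + 1) := by positivity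
      nlinarith
    | succ n ihn =>
      rw [← add_assoc, counterUrn, urnStep]
      have h : ∀ k ν, jumpMean (fun k ν => counterUrn p F N (m₀ + l) N k ν)
          (fun k ν i => counterUrn p F N (m₀ + l + 1) n k (Function.update ν i (ν i + 1))) k ν
          ≤ 1 - θ * (1 - A * (1 / 2) ^ k * (1 - p₀ / 2) ^ l) := by
        refine fun k ν => jumpMean_le (ihl _ _ _) fun i _ => (ihn _ _).trans ?_
        have : (1 - p₀ / 2) ^ (l + 1) ≤ (1 - p₀ / 2) ^ l :=
          pow_le_pow_of_le_one hl0 (by linarith) (by omega)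
        gcongr
      have h1 := h k ν
      have h2 := h (k + 1) (Function.update ν k 0)
      rw [pow_succ (1 / 2 : ℝ) k] at h2
      rw [pow_succ (1 - p₀ / 2) l]
      have h3 : 0 ≤ A * (1 / 2) ^ k * (1 - p₀ / 2) ^ l := by positivity
      rw [← mul_assoc A ((1 / 2) ^ k) (1 / 2), mul_right_comm (A * (1 / 2) ^ k)] at h2
      rw [← mul_assoc (A * (1 / 2) ^ k)]
      generalize A * (1 / 2) ^ k * (1 - p₀ / 2) ^ l = x at *
      have h4 : θ * x * (p₀ / 2) ≤ θ * x * (p / 2) := by gcongr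
      nlinarith

/-- If enough visits are paid to a new vertex, then the payoff improves on itself. -/
theorem exists_counterUrn_le {p₀ : ℝ} (hp0 : 0 < p₀) (hp1 : p₀ ≤ 1) :
    ∃ (M : ℕ) (δ : ℝ), 0 < M ∧ 0 < δ ∧ δ ≤ 1 ∧ ∀ p, p₀ ≤ p → p ≤ 1 → ∀ N ν,
      counterUrn p (payoff δ M) N M N 0 ν ≤ 1 - δ := by
  obtain ⟨l, hl⟩ := exists_pow_lt_of_lt_one (show (0 : ℝ) < 1 / 2 ^ 57 by positivity)
    (show 1 - p₀ / 2 < 1 by linarith)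
  obtain ⟨m₀, hm⟩ := exists_win_ge l
  have hl0 : 0 ≤ 1 - p₀ / 2 := by linarith
  have hl' : (1 - p₀ / 2) ^ (2 * l + 1) < 1 / 2 ^ 57 :=
    (pow_le_pow_of_le_one hl0 (by linarith) (by omega)).trans_lt hl
  -- With 56 children and chance 1/14 each, four full counters are expected and the loss is `4 * δ /
  -- 2 = 1 / 28 = θ`. The growth error `2 ^ 56 * (1 - p₀ / 2) ^ (2 * l + 1)` is below 1/2, so `θ / 2
  -- = δ` remains.
  refine ⟨m₀ + (2 * l + 1), 1 / 56, by omega, by norm_num, by norm_num, fun p h1 h2 N ν => ?_⟩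
  have hp : 0 ≤ p := hp0.le.trans h1
  have key := counterUrn_le_growth (F := payoff (1 / 56) (m₀ + (2 * l + 1))) (N := N) (m₀ := m₀)
    (θ := 1 / 28) (A := 2 ^ 56) hp0.le h1 h2 (by norm_num) (by norm_num) (by norm_num) ?_
    (2 * l + 1) N 0 ν
  · refine key.trans ?_
    generalize (1 - p₀ / 2) ^ (2 * l + 1) = y at *
    norm_num at hl' ⊢
    linarith
  · intro n k ν
    by_cases hk : 56 ≤ k
    · have h3 := counterUrn_le_reachSum (N := N) (δ := 1 / 56) (M := m₀ + (2 * l + 1)) (J := 56)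
        hp h2 (by norm_num) (by norm_num) (by norm_num) m₀ n k hk ν
      have h4 : (56 : ℝ) * (1 / 14) ≤ reachSum (m₀ + (2 * l + 1)) 56 m₀ ν := by
        have := Finset.card_nsmul_le_sum (Finset.range 56)
          (fun i => win (m₀ + (2 * l + 1) - ν i) m₀) (1 / 14)
          (fun i _ => hm.trans (win_anti_left m₀ (Nat.sub_le _ _)))
        simpa [reachSum] using this
      have : (0 : ℝ) ≤ 2 ^ 56 * (1 / 2) ^ k := by positivity
      linarith
    -- With fewer than 56 children the factor `2 ^ 56` makes the claimed bound at least `1`.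
    · have h3 := counterUrn_le_one (N := N) hp h2 (payoff_nonneg (δ := 1 / 56) (by norm_num)
        (m₀ + (2 * l + 1))) (payoff_le_one (by norm_num) _) m₀ n k ν
      have h5 : (1 : ℝ) ≤ 2 ^ 56 * (1 / 2) ^ k := by
        have : ((1 : ℝ) / 2) ^ 56 ≤ (1 / 2) ^ k :=
          pow_le_pow_of_le_one (by norm_num) (by norm_num) (by omega)
        calc (1 : ℝ) = 2 ^ 56 * (1 / 2) ^ 56 := by norm_num
          _ ≤ _ := by gcongr
      linarith

/-- A single visit to a new vertex has a chance to bring `M` visits to one of its children. -/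
theorem counterUrn_one_le {δ : ℝ} {M : ℕ} (hp0 : 0 ≤ p) (hp1 : p ≤ 1) (hδ0 : 0 ≤ δ)
    (hδ1 : δ ≤ 1) (n : ℕ) (ν : ℕ → ℕ) :
    counterUrn p (payoff δ M) N 1 n 0 ν ≤ 1 - p * (δ * win M 1 / 4) := by
  cases n with
  | zero =>
    rw [counterUrn]
    have : δ * win M 1 ≤ 1 * 1 := mul_le_mul hδ1 (win_le_one _ _) (win_nonneg _ _) zero_le_one
    have : 0 ≤ δ * win M 1 := mul_nonneg hδ0 (win_nonneg _ _)
    nlinarith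
  | succ n =>
    rw [counterUrn, urnStep]
    have hle := counterUrn_le_one (N := N) hp0 hp1 (payoff_nonneg hδ1 M)
      (payoff_le_one hδ0 M)
    have h1 : jumpMean (fun k ν => counterUrn p (payoff δ M) N 0 N k ν)
          (fun k ν i => counterUrn p (payoff δ M) N (0 + 1) n k
            (Function.update ν i (ν i + 1))) 0 ν ≤ 1 := jumpMean_le (hle _ _ _ _) fun i _ => hle _ _ _ _
    -- The first child, once born, is entered with probability 1/2, and `counterUrn_le_reachSum`
    -- with `J = 1` then yields a loss `δ / 2 * win M 1`.
    have h2 : jumpMean (fun k ν => counterUrn p (payoff δ M) N 0 N k ν)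
          (fun k ν i => counterUrn p (payoff δ M) N (0 + 1) n k
            (Function.update ν i (ν i + 1))) (0 + 1) (Function.update ν 0 0) ≤
          1 - δ * win M 1 / 4 := by
      have h3 := counterUrn_le_reachSum (N := N) (M := M) (J := 1) hp0 hp1 hδ0 hδ1
        (by simpa using hδ1) 1 n 1 le_rfl
        (Function.update (Function.update ν 0 0) 0 (Function.update ν 0 0 0 + 1))
      have h4 := hle 0 N 1 (Function.update ν 0 0)
      have h5 : win M 1 ≤ win (M - 1) 1 := win_anti_left 1 (Nat.sub_le _ _)
      simp only [reachSum, Finset.sum_range_one, Function.update_self, zero_add,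
        Function.update_idem] at h3
      have h6 : δ * win M 1 ≤ δ * win (M - 1) 1 := mul_le_mul_of_nonneg_left h5 hδ0
      rw [jumpMean]
      simp only [zero_add, Finset.sum_range_one, Function.update_self, Function.update_idem,
        Nat.cast_one]
      linarith
    nlinarith

theorem win_one_pos (M : ℕ) : 0 < win M 1 := by
  induction M with
  | zero => simp [win]
  | succ M ih => rw [win]; linarith [win_nonneg (M + 1) 0]

end CounterUrn

/-! ### Excursions on abstract trees -/

/-- Rooted plane trees, as a number of children and a sequence whose first terms are the subtrees
of the children. -/
inductive Tree
  | nil : Tree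
  | node (k : ℕ) (c : ℕ → Tree) : Tree

/-- The tree with a single vertex. -/
def Tree.leaf : Tree := .node 0 fun _ => .nil

/-- A positive linear functional of mass at most `1`. -/
structure SubMean {α : Type*} (l : (α → ℝ) → ℝ) : Prop where
  lin : ∀ (f g : α → ℝ) (a : ℝ), l (fun t => f t + a * g t) = l f + a * l g
  mono : ∀ f g : α → ℝ, (∀ t, f t ≤ g t) → l f ≤ l g
  one : l (fun _ => 1) ≤ 1

namespace SubMean

variable {α β : Type*} {l : (α → ℝ) → ℝ} (hl : SubMean l)
include hl

theorem zero : l (fun _ => 0) = 0 := by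
  have := hl.lin (fun _ => 0) (fun _ => 0) 1
  simp at this; exact this

theorem add (f g : α → ℝ) : l (fun t => f t + g t) = l f + l g := by
  simpa using hl.lin f g 1

theorem smul (a : ℝ) (g : α → ℝ) : l (fun t => a * g t) = a * l g := by
  simpa [hl.zero] using hl.lin (fun _ => 0) g a

theorem sum (s : Finset ℕ) (f : ℕ → α → ℝ) :
    l (fun t => ∑ i ∈ s, f i t) = ∑ i ∈ s, l (f i) := by
  induction s using Finset.induction_on with
  | empty => simpa using hl.zero
  | insert i s hi ih => simp only [Finset.sum_insert hi]; rw [hl.add, ih]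

theorem nonneg (f : α → ℝ) (hf : ∀ t, 0 ≤ f t) : 0 ≤ l f := by
  simpa [hl.zero] using hl.mono (fun _ => 0) f hf

theorem jumpMean (exit : α → ℕ → (ℕ → β) → ℝ) (visit : α → ℕ → (ℕ → β) → ℕ → ℝ) (k : ℕ)
    (c : α → ℕ → β) : l (fun t => jumpMean (exit t) (visit t) k (c t)) =
      (l (fun t => exit t k (c t)) + ∑ i ∈ Finset.range k, l (fun t => visit t k (c t) i)) /
        (k + 1) := by
  simp only [BGRW.jumpMean, div_eq_inv_mul]
  rw [hl.smul, hl.add, hl.sum]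

theorem urnStep (p : ℝ) (new : β) (exit : α → ℕ → (ℕ → β) → ℝ)
    (visit : α → ℕ → (ℕ → β) → ℕ → ℝ) (k : ℕ) (c : α → ℕ → β) :
    l (fun t => urnStep p new (exit t) (visit t) k (c t)) =
      (1 - p) * l (fun t => BGRW.jumpMean (exit t) (visit t) k (c t)) +
      p * l (fun t =>
        BGRW.jumpMean (exit t) (visit t) (k + 1) (Function.update (c t) k new)) := by
  simp only [BGRW.urnStep]
  rw [hl.add, hl.smul, hl.smul]

end SubMean

/-- Given the law `R` of the excursions into the subtrees of the children, the law of the tree after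
an excursion that starts at the root and leaves it to the parent within `n` departures. -/
def loop (p : ℝ) (R : Tree → (Tree → ℝ) → ℝ) : ℕ → Tree → (Tree → ℝ) → ℝ
  | 0, _, _ => 0
  | _ + 1, .nil, _ => 0
  | n + 1, .node k c, κ => urnStep p Tree.leaf (fun k c => κ (.node k c))
      (fun k c i => R (c i) fun t => loop p R n (.node k (Function.update c i t)) κ) k c

/-- The law of the tree after an excursion that stays below depth `h` and makes at most `N`
departures from a vertex between two arrivals from its parent. -/
def excursion (p : ℝ) (N : ℕ) : ℕ → Tree → (Tree → ℝ) → ℝ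
  | 0 => fun _ _ => 0
  | h + 1 => loop p (excursion p N h) N

/-- The probability that `m` successive excursions all return. -/
def returns (R : Tree → (Tree → ℝ) → ℝ) : ℕ → Tree → ℝ
  | 0, _ => 1
  | m + 1, t => R t (returns R m)

variable {p : ℝ}

theorem loop_subMean (hp0 : 0 ≤ p) (hp1 : p ≤ 1) {R : Tree → (Tree → ℝ) → ℝ}
    (hR : ∀ t, SubMean (R t)) (n : ℕ) (t : Tree) : SubMean (loop p R n t) := by
  have trivial : SubMean (fun _ : Tree → ℝ => (0 : ℝ)) := ⟨by simp, by simp, by simp⟩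
  induction n generalizing t with
  | zero => simpa [loop, funext_iff] using trivial
  | succ n ih =>
    rcases t with _ | ⟨k, c⟩
    · simpa [loop, funext_iff] using trivial
    refine ⟨fun f g a => ?_, fun f g hfg => ?_, ?_⟩
    · simp only [loop, urnStep, jumpMean, (ih _).lin, (hR _).lin, Finset.sum_add_distrib,
        ← Finset.mul_sum]
      ring
    · simp only [loop, urnStep]
      gcongr ?_ * ?_ + ?_ * ?_
      · exact jumpMean_mono (hfg _) fun i _ => (hR _).mono _ _ fun t => (ih _).mono _ _ hfg
      · exact jumpMean_mono (hfg _) fun i _ => (hR _).mono _ _ fun t => (ih _).mono _ _ hfg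
    · simp only [loop, urnStep]
      have h : ∀ k c, jumpMean (fun _ _ => 1) (fun k c i => R (c i) fun t =>
          loop p R n (.node k (Function.update c i t)) fun _ => 1) k c ≤ 1 := fun k c =>
        jumpMean_le le_rfl fun i _ => ((hR _).mono _ _ fun t => (ih _).one).trans (hR _).one
      nlinarith [h k c, h (k + 1) (Function.update c k Tree.leaf)]

theorem excursion_subMean (hp0 : 0 ≤ p) (hp1 : p ≤ 1) (N h : ℕ) (t : Tree) :
    SubMean (excursion p N h t) := by
  induction h generalizing t with
  | zero => exact ⟨by simp [excursion], by simp [excursion], by simp [excursion]⟩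
  | succ h ih => exact loop_subMean hp0 hp1 ih N t

theorem returns_nonneg {R : Tree → (Tree → ℝ) → ℝ} (hR : ∀ t, SubMean (R t)) (m : ℕ) (t : Tree) :
    0 ≤ returns R m t := by
  induction m generalizing t with
  | zero => exact zero_le_one
  | succ m ih => exact (hR t).nonneg _ ih

theorem returns_anti {R : Tree → (Tree → ℝ) → ℝ} (hR : ∀ t, SubMean (R t)) (t : Tree) :
    Antitone fun m => returns R m t := by
  refine antitone_nat_of_succ_le fun m => ?_
  induction m generalizing t with
  | zero => exact (hR t).one
  | succ m ih => exact (hR t).mono _ _ ih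

/-! ### Independence of excursions into different subtrees -/

/-- The urn whose child `i` pays `φ i j` for `j` visits, and whose new children pay `f j`. -/
def payoffUrn (p : ℝ) (f : ℕ → ℝ) (N : ℕ) : ℕ → ℕ → ℕ → (ℕ → ℕ → ℝ) → ℝ
  | 0, _, k, φ => ∏ i ∈ Finset.range k, φ i 0
  | _ + 1, 0, _, _ => 0
  | m + 1, n + 1, k, φ => urnStep p f (fun k φ => payoffUrn p f N m N k φ)
      (fun k φ i => payoffUrn p f N (m + 1) n k (Function.update φ i fun j => φ i (j + 1))) k φ
termination_by m n => (m, n)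

/-- For `i < k` the final product has exactly one factor from child `i`, so the urn is linear in
that child's payoff sequence. A mean over the outcome of an excursion into its subtree can thus be
moved inside. -/
theorem payoffUrn_comm {α : Type*} {f : ℕ → ℝ} {N : ℕ} {l : (α → ℝ) → ℝ} (hl : SubMean l)
    (m n k : ℕ) (φ : ℕ → ℕ → ℝ) (i : ℕ) (hi : i < k) (g : α → ℕ → ℝ) :
    l (fun t => payoffUrn p f N m n k (Function.update φ i (g t))) =
      payoffUrn p f N m n k (Function.update φ i fun j => l fun t => g t j) := by
  induction m generalizing n k φ g with
  | zero =>
    simp only [payoffUrn]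
    have h (x : ℕ → ℝ) : ∏ r ∈ Finset.range k, Function.update φ i x r 0 =
        (∏ r ∈ (Finset.range k).erase i, φ r 0) * x 0 := by
      rw [← Finset.prod_erase_mul _ _ (Finset.mem_range.2 hi), Function.update_self]
      congr 1
      refine Finset.prod_congr rfl fun r hr => ?_
      rw [Function.update_of_ne (Finset.ne_of_mem_erase hr)]
    simp only [h, hl.smul]
  | succ m ihm =>
    induction n generalizing k φ g with
    | zero => simp only [payoffUrn, hl.zero]
    | succ n ihn =>
      have key : ∀ k φ, i < k → l (fun t => jumpMean (fun k φ => payoffUrn p f N m N k φ)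
          (fun k φ i => payoffUrn p f N (m + 1) n k (Function.update φ i fun j => φ i (j + 1))) k
          (Function.update φ i (g t))) = jumpMean (fun k φ => payoffUrn p f N m N k φ)
          (fun k φ i => payoffUrn p f N (m + 1) n k (Function.update φ i fun j => φ i (j + 1))) k
          (Function.update φ i fun j => l fun t => g t j) := by
        intro k φ hi
        rw [hl.jumpMean, jumpMean, ihm _ _ _ hi]
        congr 2
        refine Finset.sum_congr rfl fun r _ => ?_
        by_cases hr : r = i
        · subst hr
          simp only [Function.update_self, Function.update_idem]
          exact ihn k φ hi fun t j => g t (j + 1)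
        · simp only [Function.update_of_ne hr]
          simp only [Function.update_comm (Ne.symm hr)]
          exact ihn k _ hi g
      simp only [payoffUrn]
      rw [hl.urnStep, urnStep, key k φ hi]
      simp only [Function.update_comm hi.ne]
      rw [key (k + 1) _ (hi.trans (Nat.lt_succ_self k))]

/-- Excursions into different subtrees are independent given the numbers of visits. -/
theorem loop_returns {R : Tree → (Tree → ℝ) → ℝ} (hR : ∀ t, SubMean (R t)) (N m n k : ℕ)
    (c : ℕ → Tree) : loop p R n (.node k c) (returns (loop p R N) m) =
      payoffUrn p (fun j => returns R j Tree.leaf) N (m + 1) n k (fun i j => returns R j (c i)) := by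
  have step : ∀ m, (∀ k c, returns (loop p R N) m (.node k c) =
      payoffUrn p (fun j => returns R j Tree.leaf) N m N k fun i j => returns R j (c i)) → ∀ n k c,
      loop p R n (.node k c) (returns (loop p R N) m) =
      payoffUrn p (fun j => returns R j Tree.leaf) N (m + 1) n k
        (fun i j => returns R j (c i)) := by
    intro m exits n
    induction n with
    | zero => intro k c; simp only [loop, payoffUrn]
    | succ n ihn =>
      intro k c
      have upd : ∀ (c : ℕ → Tree) i t, (fun r j => returns R j (Function.update c i t r)) =
          Function.update (fun r j => returns R j (c r)) i fun j => returns R j t := by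
        intro c i t
        funext r
        rcases eq_or_ne r i with rfl | hr
        · simp
        · simp [hr]
      have key : ∀ k c, jumpMean (fun k c => returns (loop p R N) m (.node k c))
          (fun k c i => R (c i) fun t => loop p R n (.node k (Function.update c i t))
            (returns (loop p R N) m)) k c =
          jumpMean (fun k φ => payoffUrn p (fun j => returns R j Tree.leaf) N m N k φ)
          (fun k φ i => payoffUrn p (fun j => returns R j Tree.leaf) N (m + 1) n k
            (Function.update φ i fun j => φ i (j + 1))) k (fun i j => returns R j (c i)) := by
        intro k c
        rw [jumpMean, jumpMean, exits]
        congr 2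
        refine Finset.sum_congr rfl fun i hi => ?_
        simp only [ihn, upd]
        exact payoffUrn_comm (hR (c i)) _ _ _ _ _ (Finset.mem_range.1 hi) _
      rw [loop, payoffUrn, urnStep, urnStep, key, key, upd]
  induction m generalizing n k c with
  | zero => exact step 0 (fun k c => by simp [returns, payoffUrn]) n k c
  | succ m ihm =>
    exact step (m + 1) (fun k c => ihm N k c) n k c

/-- The counter `ν i` records how many entries of the bound `F` child `i` has used: a visit shifts
its payoff sequence by one and raises its counter by one. -/
theorem payoffUrn_le_counterUrn (hp0 : 0 ≤ p) (hp1 : p ≤ 1) {f F : ℕ → ℝ} {N : ℕ}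
    (hf0 : ∀ j, 0 ≤ f j) (hf : ∀ j, f j ≤ F j) (m n k : ℕ) (φ : ℕ → ℕ → ℝ) (ν : ℕ → ℕ)
    (hφ0 : ∀ i < k, ∀ j, 0 ≤ φ i j) (hφ : ∀ i < k, ∀ j, φ i j ≤ F (ν i + j)) :
    payoffUrn p f N m n k φ ≤ counterUrn p F N m n k ν := by
  induction m generalizing n k φ ν with
  | zero =>
    rw [payoffUrn, counterUrn]
    exact Finset.prod_le_prod (fun i hi => hφ0 i (Finset.mem_range.1 hi) 0)
      (fun i hi => hφ i (Finset.mem_range.1 hi) 0)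
  | succ m ihm =>
    induction n generalizing k φ ν with
    | zero => rw [payoffUrn, counterUrn]
    | succ n ihn =>
      rw [payoffUrn, counterUrn, urnStep, urnStep]
      have key : ∀ k φ ν, (∀ i < k, ∀ j, 0 ≤ φ i j) → (∀ i < k, ∀ j, φ i j ≤ F (ν i + j)) →
          jumpMean (fun k φ => payoffUrn p f N m N k φ) (fun k φ i =>
            payoffUrn p f N (m + 1) n k (Function.update φ i fun j => φ i (j + 1))) k φ ≤
          jumpMean (fun k ν => counterUrn p F N m N k ν)
            (fun k ν i => counterUrn p F N (m + 1) n k (Function.update ν i (ν i + 1))) k ν := by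
        intro k φ ν h0 h1
        refine jumpMean_mono (ihm _ _ _ _ h0 h1) fun i hi => ihn _ _ _ ?_ ?_
        · intro r hr j
          rcases eq_or_ne r i with rfl | hri
          · simpa using h0 r hr (j + 1)
          · simpa [hri] using h0 r hr j
        · intro r hr j
          rcases eq_or_ne r i with rfl | hri
          · simpa [add_assoc, add_comm 1] using h1 r hr (j + 1)
          · simpa [hri] using h1 r hr j
      have h1 := key k φ ν hφ0 hφ
      have h2 := key (k + 1) (Function.update φ k f) (Function.update ν k 0) ?_ ?_
      · have : 0 ≤ 1 - p := by linarith
        gcongr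
      · intro r hr j
        rcases eq_or_ne r k with rfl | hri
        · simpa using hf0 j
        · simpa [hri] using hφ0 r (by omega) j
      · intro r hr j
        rcases eq_or_ne r k with rfl | hri
        · simpa using hf j
        · simpa [hri] using hφ r (by omega) j

/-- The growing walk on a new vertex escapes with probability bounded away from `0`. -/
theorem exists_excursion_leaf_le {p₀ : ℝ} (hp0 : 0 < p₀) (hp1 : p₀ ≤ 1) :
    ∃ q : ℝ, 0 < q ∧ q < 1 ∧ ∀ p, p₀ ≤ p → p ≤ 1 → ∀ N h,
      excursion p N h Tree.leaf (fun _ => 1) ≤ q := by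
  obtain ⟨M, δ, hM, hδ0, hδ1, key⟩ := exists_counterUrn_le hp0 hp1
  have hw := win_one_pos M
  have hw1 : δ * win M 1 ≤ 1 * 1 := mul_le_mul hδ1 (win_le_one _ _) hw.le zero_le_one
  have hw2 := mul_pos hδ0 hw
  refine ⟨1 - p₀ * (δ * win M 1 / 4), by nlinarith, by nlinarith [mul_pos hp0 hw2],
    fun p h1 h2 N h => ?_⟩
  have hp : 0 ≤ p := hp0.le.trans h1
  have hS := excursion_subMean hp h2 N
  have step : ∀ h, (∀ j, returns (excursion p N h) j Tree.leaf ≤ payoff δ M j) → ∀ m,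
      returns (excursion p N (h + 1)) (m + 1) Tree.leaf ≤
        counterUrn p (payoff δ M) N (m + 1) N 0 fun _ => 0 := by
    intro h ih m
    have : returns (excursion p N (h + 1)) (m + 1) Tree.leaf =
      loop p (excursion p N h) N Tree.leaf (returns (loop p (excursion p N h) N) m) := rfl
    rw [this, Tree.leaf, loop_returns (hS h)]
    exact payoffUrn_le_counterUrn hp h2 (fun j => returns_nonneg (hS h) _ _) ih _ _ _ _ _
      (by simp) (by simp)
  have main : ∀ h j, returns (excursion p N h) j Tree.leaf ≤ payoff δ M j := by
    have small : ∀ h j, j < M → returns (excursion p N h) j Tree.leaf ≤ payoff δ M j := by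
      intro h j hj
      obtain ⟨i, hi⟩ : ∃ i, M - j = i + 1 := ⟨M - j - 1, by omega⟩
      rw [payoff, hi, win, mul_zero, sub_zero]
      exact returns_anti (hS h) _ (Nat.zero_le j)
    intro h
    induction h with
    | zero =>
      intro j
      rcases j with _ | j
      · exact small 0 0 hM
      -- At depth `0` no excursion returns, so the probability of `j + 1` returns is `0`.
      · exact payoff_nonneg hδ1 M (j + 1)
    | succ h ih =>
      intro j
      rcases lt_or_ge j M with hj | hj
      · exact small _ _ hj
      · obtain ⟨M, rfl⟩ : ∃ M', M = M' + 1 := ⟨M - 1, by omega⟩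
        rw [payoff, Nat.sub_eq_zero_of_le hj, win_zero, mul_one]
        exact (returns_anti (hS _) _ hj).trans ((step h ih M).trans (key p h1 h2 N _))
  rcases h with _ | h
  · simp only [excursion]; nlinarith
  · refine (step h (main h) 0).trans ((counterUrn_one_le hp h2 hδ0.le hδ1 _ _).trans ?_)
    have := mul_le_mul_of_nonneg_right h1 (show 0 ≤ δ * win M 1 / 4 by positivity)
    linarith

/-! ### One step of the walk -/

namespace State

variable (s : State)

theorem fresh_ne {v : ℕ} (hv : v ∈ s.tree.verts) : v ≠ s.fresh := fun h => s.fresh_notMem (h ▸ hv)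

@[simp] theorem grow_pos : s.grow.pos = s.pos := rfl

theorem grow_adj (a b : ℕ) : s.grow.tree.Adj a b ↔
    s.tree.Adj a b ∨ (a = s.pos ∧ b = s.fresh) ∨ (a = s.fresh ∧ b = s.pos) := by
  change s.grownTree.Adj a b ↔ _
  simp only [grownTree, SimpleGraph.Subgraph.sup_adj, SimpleGraph.subgraphOfAdj_adj, Sym2.eq_iff]
  grind

theorem mem_grow_verts (a : ℕ) : a ∈ s.grow.tree.verts ↔ a ∈ s.tree.verts ∨ a = s.fresh := by
  change a ∈ s.grownTree.verts ↔ _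
  simp only [grownTree, SimpleGraph.Subgraph.verts_sup, SimpleGraph.subgraphOfAdj_verts,
    Set.mem_union, Set.mem_insert_iff, Set.mem_singleton_iff]
  have := s.pos_mem
  grind

theorem le_grow : s.tree ≤ s.grow.tree := le_sup_left

/-- The neighbours of the walker's position. -/
def nb : Finset ℕ := (s.finite_neighborSet s.pos).toFinset

@[simp] theorem mem_nb (v : ℕ) : v ∈ s.nb ↔ s.tree.Adj s.pos v := by simp [nb]

open Classical in
/-- Move the walker to `v` if `v` is a neighbour of its position. -/
def goto (v : ℕ) : State := if h : s.tree.Adj s.pos v then s.moveTo ⟨v, h⟩ else s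

@[simp] theorem goto_tree (v : ℕ) : (s.goto v).tree = s.tree := by
  unfold goto; split <;> rfl

theorem goto_pos {v : ℕ} (h : s.tree.Adj s.pos v) : (s.goto v).pos = v := by
  rw [goto, dif_pos h]; rfl

theorem nb_grow : s.grow.nb = insert s.fresh s.nb := by
  ext v
  have := s.pos_ne_fresh
  simp only [mem_nb, grow_adj, grow_pos, Finset.mem_insert]
  grind

theorem fresh_notMem_nb : s.fresh ∉ s.nb := fun h =>
  s.fresh_notMem ((s.mem_nb _).1 h).snd_mem

open Classical in
/-- The mean of `h` after the walker jumps to a uniform neighbour. -/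
def jumpAvg (h : State → ℝ) : ℝ :=
  if s.nb.Nonempty then (∑ v ∈ s.nb, h (s.goto v)) / s.nb.card else h s

/-- The mean of `h` after one step of the walk. -/
def stepAvg (p : ℝ) (h : State → ℝ) : ℝ := p * s.grow.jumpAvg h + (1 - p) * s.jumpAvg h

/-- The state `t` can arise from `s` by a jump. -/
def Jumps (t : State) : Prop := t.tree = s.tree ∧ (s.tree.Adj s.pos t.pos ∨ t = s)

/-- The state `t` can arise from `s` in one step of the walk. -/
def Steps (t : State) : Prop := s.Jumps t ∨ s.grow.Jumps t

theorem Steps.le {s t : State} (h : s.Steps t) : s.tree ≤ t.tree := by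
  rcases h with h | h
  · exact h.1.ge
  · rw [h.1]; exact s.le_grow

theorem jumps_goto {v : ℕ} (hv : v ∈ s.nb) : s.Jumps (s.goto v) :=
  ⟨s.goto_tree v, .inl (by rw [goto_pos] <;> simpa using hv)⟩

theorem jumpAvg_mono {g h : State → ℝ} (H : ∀ t, s.Jumps t → g t ≤ h t) :
    s.jumpAvg g ≤ s.jumpAvg h := by
  unfold jumpAvg
  split_ifs
  · gcongr with v hv
    exact H _ (s.jumps_goto hv)
  · exact H _ ⟨rfl, .inr rfl⟩

theorem jumpAvg_lin (g h : State → ℝ) (a : ℝ) :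
    s.jumpAvg (fun t => g t + a * h t) = s.jumpAvg g + a * s.jumpAvg h := by
  unfold jumpAvg
  split_ifs
  · rw [Finset.sum_add_distrib, ← Finset.mul_sum]; ring
  · rfl

theorem jumpAvg_one : s.jumpAvg (fun _ => 1) = 1 := by
  unfold jumpAvg
  split_ifs with h
  · have : (s.nb.card : ℝ) ≠ 0 := by exact_mod_cast (Finset.card_pos.2 h).ne'
    simp [this]
  · rfl

variable {p : ℝ}

theorem stepAvg_mono (hp0 : 0 ≤ p) (hp1 : p ≤ 1) {g h : State → ℝ}
    (H : ∀ t, s.Steps t → g t ≤ h t) : s.stepAvg p g ≤ s.stepAvg p h := by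
  have h1 := s.grow.jumpAvg_mono fun t ht => H t (.inr ht)
  have h2 := s.jumpAvg_mono fun t ht => H t (.inl ht)
  have : 0 ≤ 1 - p := by linarith
  unfold stepAvg; gcongr

theorem stepAvg_lin (g h : State → ℝ) (a : ℝ) :
    s.stepAvg p (fun t => g t + a * h t) = s.stepAvg p g + a * s.stepAvg p h := by
  simp only [stepAvg, jumpAvg_lin]; ring

theorem stepAvg_one : s.stepAvg p (fun _ => 1) = 1 := by
  simp [stepAvg, jumpAvg_one]

theorem stepAvg_smul (g : State → ℝ) (a : ℝ) :
    s.stepAvg p (fun t => a * g t) = a * s.stepAvg p g := by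
  have h0 := s.stepAvg_lin (p := p) (fun _ => 0) (fun _ => 0) 1
  have h := s.stepAvg_lin (p := p) (fun _ => 0) g a
  simp at h0 h; rw [h, h0, zero_add]

theorem stepAvg_const (a : ℝ) : s.stepAvg p (fun _ => a) = a := by
  simpa [stepAvg_one] using s.stepAvg_smul (p := p) (fun _ => 1) a

theorem stepAvg_le (hp0 : 0 ≤ p) (hp1 : p ≤ 1) {g : State → ℝ} {b : ℝ}
    (H : ∀ t, s.Steps t → g t ≤ b) : s.stepAvg p g ≤ b :=
  (s.stepAvg_mono hp0 hp1 H).trans (s.stepAvg_const b).le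

theorem stepAvg_nonneg (hp0 : 0 ≤ p) (hp1 : p ≤ 1) {g : State → ℝ}
    (H : ∀ t, s.Steps t → 0 ≤ g t) : 0 ≤ s.stepAvg p g :=
  (s.stepAvg_const 0).ge.trans (s.stepAvg_mono hp0 hp1 H)

theorem lintegral_jump (h : State → ℝ) (h0 : ∀ t, 0 ≤ h t) :
    ∫⁻ t, ENNReal.ofReal (h t) ∂s.jump.toMeasure = ENNReal.ofReal (s.jumpAvg h) := by
  classical
  by_cases hne : (s.tree.neighborSet s.pos).Nonempty
  · have := hne.to_subtype
    have := (s.finite_neighborSet s.pos).fintype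
    let _ : MeasurableSpace (s.tree.neighborSet s.pos) := ⊤
    have hj : s.jump = (PMF.uniformOfFintype (s.tree.neighborSet s.pos)).map s.moveTo := by
      rw [jump, dif_pos hne]; congr!
    have hnb : s.nb.Nonempty := by simpa [nb] using hne
    have hcard : s.nb.card = Fintype.card (s.tree.neighborSet s.pos) := by
      rw [nb, Set.Finite.card_toFinset]
    rw [hj, ← PMF.toMeasure_map (hf := measurable_from_top),
      lintegral_map measurable_from_top measurable_from_top, lintegral_fintype, jumpAvg, if_pos hnb]
    have hpos : (0 : ℝ) < s.nb.card := by exact_mod_cast Finset.card_pos.2 hnb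
    have h1 : ∀ x : s.tree.neighborSet s.pos, ENNReal.ofReal (h (s.moveTo x)) *
        (PMF.uniformOfFintype (s.tree.neighborSet s.pos)).toMeasure {x} =
        ENNReal.ofReal (h (s.goto x) / s.nb.card) := by
      intro x
      have hx : s.goto x = s.moveTo x := dif_pos x.2
      rw [hx, PMF.toMeasure_apply_singleton _ _ (MeasurableSet.singleton x),
        PMF.uniformOfFintype_apply, ← hcard, ENNReal.ofReal_div_of_pos hpos, ENNReal.ofReal_natCast,
        ENNReal.div_eq_inv_mul, mul_comm]
    rw [Finset.sum_congr rfl fun x _ => h1 x, Finset.sum_div,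
      ← ENNReal.ofReal_sum_of_nonneg fun x _ => div_nonneg (h0 _) hpos.le]
    congr 1
    exact (Finset.sum_subtype s.nb (by simp) fun v => h (s.goto v) / s.nb.card).symm
  · have hnb : ¬ s.nb.Nonempty := by simpa [nb] using hne
    rw [jump, dif_neg hne, jumpAvg, if_neg hnb, PMF.toMeasure_pure, lintegral_dirac]

end State

theorem lintegral_step (p : unitInterval) (s : State) (h : State → ℝ) (h0 : ∀ t, 0 ≤ h t) :
    ∫⁻ t, ENNReal.ofReal (h t) ∂step p s = ENNReal.ofReal (s.stepAvg p h) := by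
  have hp : 0 ≤ 1 - (p : ℝ) := sub_nonneg.2 p.2.2
  have hj : ∀ s : State, 0 ≤ s.jumpAvg h := fun s => by
    have := s.jumpAvg_mono (g := fun _ => 0 * 1) (h := h) fun t _ => by simpa using h0 t
    have h2 := s.jumpAvg_lin (fun _ => 0) (fun _ => 0) 1
    simp at this h2
    rwa [h2] at this
  rw [step, lintegral_add_measure, lintegral_smul_measure, lintegral_smul_measure,
    State.lintegral_jump _ _ h0, State.lintegral_jump _ _ h0, smul_eq_mul, smul_eq_mul,
    ← ENNReal.ofReal_mul p.2.1, ← ENNReal.ofReal_mul hp,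
    ← ENNReal.ofReal_add (mul_nonneg p.2.1 (hj _)) (mul_nonneg hp (hj _)), State.stepAvg]

/-! ### Hitting a vertex -/

/-- The mean of `g` at the first visit to `y`, on the event that it happens within `n` steps. -/
def hit (p : ℝ) (y : ℕ) (g : State → ℝ) : ℕ → State → ℝ
  | 0, s => if s.pos = y then g s else 0
  | n + 1, s => if s.pos = y then g s else s.stepAvg p (hit p y g n)

section Hit

variable {p : ℝ} (hp0 : 0 ≤ p) (hp1 : p ≤ 1) {y v : ℕ} {g g' : State → ℝ}

theorem hit_of_pos {s : State} (h : s.pos = y) (n : ℕ) : hit p y g n s = g s := by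
  cases n <;> simp [hit, h]

include hp0 hp1

theorem hit_nonneg (hg : ∀ s, 0 ≤ g s) (n : ℕ) (s : State) : 0 ≤ hit p y g n s := by
  induction n generalizing s with
  | zero => rw [hit]; split_ifs <;> simp [hg]
  | succ n ih =>
    rw [hit]; split_ifs
    · exact hg s
    · exact s.stepAvg_nonneg hp0 hp1 fun t _ => ih t

theorem hit_succ_le (hg : ∀ s, 0 ≤ g s) (n : ℕ) (s : State) :
    hit p y g n s ≤ hit p y g (n + 1) s := by
  induction n generalizing s with
  | zero =>
    rw [hit, hit]; split_ifs
    · rfl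
    · exact s.stepAvg_nonneg hp0 hp1 fun t _ => hit_nonneg hp0 hp1 hg 0 t
  | succ n ih =>
    rw [hit, hit]; split_ifs
    · rfl
    · exact s.stepAvg_mono hp0 hp1 fun t _ => ih t

theorem hit_mono_time (hg : ∀ s, 0 ≤ g s) (s : State) : Monotone fun n => hit p y g n s :=
  monotone_nat_of_le_succ fun n => hit_succ_le hp0 hp1 hg n s

theorem hit_mono (n : ℕ) (s : State)
    (h : ∀ t : State, t.pos = y → s.tree ≤ t.tree → g t ≤ g' t) :
    hit p y g n s ≤ hit p y g' n s := by
  induction n generalizing s with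
  | zero =>
    rw [hit, hit]; split_ifs with hs
    · exact h s hs le_rfl
    · rfl
  | succ n ih =>
    rw [hit, hit]; split_ifs with hs
    · exact h s hs le_rfl
    · exact s.stepAvg_mono hp0 hp1 fun t ht => ih t fun u hu hu' => h u hu (ht.le.trans hu')

omit hp0 hp1 in
theorem hit_smul (a : ℝ) (n : ℕ) (s : State) :
    hit p y (fun t => a * g t) n s = a * hit p y g n s := by
  induction n generalizing s with
  | zero => rw [hit, hit]; split_ifs <;> simp
  | succ n ih =>
    rw [hit, hit]; split_ifs
    · rfl
    · simp only [funext ih, State.stepAvg_smul]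

theorem hit_le (n : ℕ) (s : State) {b : ℝ}
    (h : ∀ t : State, t.pos = y → s.tree ≤ t.tree → g t ≤ b) :
    hit p y g n s ≤ b * hit p y (fun _ => 1) n s := by
  rw [← hit_smul]
  exact hit_mono hp0 hp1 n s fun t ht hst => by simpa using h t ht hst

theorem hit_one_le_one (n : ℕ) (s : State) : hit p y (fun _ => 1) n s ≤ 1 := by
  induction n generalizing s with
  | zero => rw [hit]; split_ifs <;> simp
  | succ n ih =>
    rw [hit]; split_ifs
    · rfl
    · exact s.stepAvg_le hp0 hp1 fun t _ => ih t

end Hit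

/-! ### Separation and the strong Markov property -/

/-- The vertices in `L` can only be left through `v`. -/
structure Sep (T : (⊤ : SimpleGraph ℕ).Subgraph) (L : Set ℕ) (v : ℕ) : Prop where
  subset : L ⊆ T.verts
  notMem : v ∉ L
  adj : ∀ u ∈ L, ∀ w, T.Adj u w → w ∈ L ∨ w = v

theorem Sep.grow {s : State} {L : Set ℕ} {v : ℕ} (h : Sep s.tree L v) (hv : v ∈ s.tree.verts)
    (hs : s.pos ∈ L) : Sep s.grow.tree (insert s.fresh L) v where
  subset := by
    rintro u (rfl | hu)
    · exact (s.mem_grow_verts _).2 (.inr rfl)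
    · exact (s.mem_grow_verts _).2 (.inl (h.subset hu))
  notMem := by
    rintro (hv' | hv')
    · exact s.fresh_ne hv hv'
    · exact h.notMem hv'
  adj u hu w huw := by
    rw [State.grow_adj] at huw
    rcases huw with huw | ⟨-, rfl⟩ | ⟨-, rfl⟩
    · rcases hu with rfl | hu
      · exact absurd huw.fst_mem s.fresh_notMem
      · exact (h.adj u hu w huw).imp_left (Or.inr)
    · exact .inl (.inl rfl)
    · exact .inl (.inr hs)

/-- A new leaf hangs at the walker's position, inside `L`, so `L` with the leaf added still has `v`
as its only outlet. The leaf is not `y`, which is already a vertex. -/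
theorem Sep.step {s t : State} {L : Set ℕ} {v y : ℕ} (h : Sep s.tree L v) (hv : v ∈ s.tree.verts)
    (hs : s.pos ∈ L) (hy : y ∈ s.tree.verts) (hyL : y ∉ L) (ht : s.Steps t) :
    t.pos = v ∨ ∃ L', Sep t.tree L' v ∧ t.pos ∈ L' ∧ y ∉ L' := by
  have aux : ∀ (s t : State) (L : Set ℕ), Sep s.tree L v → s.pos ∈ L → y ∉ L → s.Jumps t →
      t.pos = v ∨ ∃ L', Sep t.tree L' v ∧ t.pos ∈ L' ∧ y ∉ L' := by
    rintro s t L h hs hy ⟨ht, ht'⟩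
    rcases ht' with ht' | rfl
    · rcases h.adj _ hs _ ht' with h' | h'
      · exact .inr ⟨L, ht ▸ h, h', hy⟩
      · exact .inl h'
    · exact .inr ⟨L, h, hs, hy⟩
  rcases ht with ht | ht
  · exact aux s t L h hs hyL ht
  · refine aux s.grow t _ (h.grow hv hs) (.inr hs) ?_ ht
    rintro (rfl | h')
    · exact s.fresh_notMem hy
    · exact hyL h'

/-- The strong Markov property: the way out of `L` passes through `v`. -/
theorem hit_le_hit {p : ℝ} (hp0 : 0 ≤ p) (hp1 : p ≤ 1) {y v : ℕ} {g : State → ℝ}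
    (hg : ∀ s, 0 ≤ g s) {n N : ℕ} (hn : n ≤ N) {s : State} {L : Set ℕ} (h : Sep s.tree L v)
    (hs : s.pos ∈ L) (hv : v ∈ s.tree.verts) (hy : y ∈ s.tree.verts) (hyL : y ∉ L) :
    hit p y g n s ≤ hit p v (hit p y g N) n s := by
  induction n generalizing s L with
  | zero =>
    rw [hit, if_neg (by rintro rfl; exact hyL hs)]
    exact hit_nonneg hp0 hp1 (hit_nonneg hp0 hp1 hg N) 0 s
  | succ n ih =>
    rw [hit, if_neg (by rintro rfl; exact hyL hs), hit, if_neg (by rintro rfl; exact h.notMem hs)]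
    refine s.stepAvg_mono hp0 hp1 fun t ht => ?_
    rcases h.step hv hs hy hyL ht with ht' | ⟨L', h1, h2, h3⟩
    · rw [hit_of_pos ht']
      exact hit_mono_time hp0 hp1 hg t (by omega)
    · exact ih (by omega) h1 h2 (ht.le.1 hv) (ht.le.1 hy) h3

/-- Every edge of a tree is a bridge; `L` is the component of `w` once the edge to `v` is removed.
-/
theorem exists_sep (s : State) {w v : ℕ} (h : s.tree.Adj w v) : ∃ L, Sep s.tree L v ∧ w ∈ L ∧
    ∀ y, (s.tree.spanningCoe.deleteEdges {s(w, v)}).Reachable v y → y ∉ L := by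
  set G := s.tree.spanningCoe.deleteEdges {s(w, v)} with hG
  have hb : ¬ G.Reachable w v := by
    have := SimpleGraph.isAcyclic_iff_forall_adj_isBridge.1 s.acyclic
      (show s.tree.spanningCoe.Adj w v from h)
    exact SimpleGraph.isBridge_iff.1 this
  refine ⟨{u | G.Reachable w u}, ⟨fun u hu => ?_, hb, fun u hu z hz => ?_⟩, .refl _,
    fun y hy hy' => hb (hy'.trans hy.symm)⟩
  · obtain ⟨q⟩ := (hu : G.Reachable w u)
    rcases eq_or_ne w u with rfl | hne
    · exact h.fst_mem
    · have := q.reverse.adj_snd (SimpleGraph.Walk.not_nil_of_ne hne.symm)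
      exact s.tree.edge_vert (SimpleGraph.deleteEdges_adj.1 this).1
  · by_cases he : s(u, z) = s(w, v)
    · rcases Sym2.eq_iff.1 he with ⟨-, rfl⟩ | ⟨rfl, -⟩
      · exact .inr rfl
      · exact absurd hu hb
    · refine .inl (SimpleGraph.Reachable.trans hu (SimpleGraph.Adj.reachable ?_))
      rw [hG, SimpleGraph.deleteEdges_adj]
      exact ⟨hz, he⟩

/-! ### Comparison of the walk with the excursions on abstract trees -/

/-- In the graph `T`, the vertices that `z` separates from its neighbour `x` form the set `L`, and
carry the shape of the rooted tree `t`. -/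
def Rep (T : (⊤ : SimpleGraph ℕ).Subgraph) : Tree → ℕ → ℕ → Set ℕ → Prop
  | .nil, _, _, _ => False
  | .node k c, x, z, L => ∃ (v : ℕ → ℕ) (Ls : ℕ → Set ℕ),
      (∀ w, T.Adj z w ↔ w = x ∨ ∃ i < k, w = v i) ∧ (∀ u, u ∈ L ↔ u = z ∨ ∃ i < k, u ∈ Ls i) ∧
      (∀ i < k, z ∉ Ls i) ∧ (∀ i < k, ∀ j < k, i ≠ j → ∀ u ∈ Ls i, u ∉ Ls j) ∧
      ∀ i < k, Rep T (c i) z (v i) (Ls i)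

/-- The graph `T'` arises from `T` by changes at the vertices of `L`, which becomes `L'`. -/
structure Frame (T : (⊤ : SimpleGraph ℕ).Subgraph) (L : Set ℕ)
    (T' : (⊤ : SimpleGraph ℕ).Subgraph) (L' : Set ℕ) : Prop where
  le : T ≤ T'
  adj : ∀ u ∈ T.verts, u ∉ L → ∀ w, T'.Adj u w ↔ T.Adj u w
  mem_iff : ∀ u ∈ T.verts, u ∈ L' ↔ u ∈ L

theorem Frame.refl (T : (⊤ : SimpleGraph ℕ).Subgraph) (L : Set ℕ) : Frame T L T L :=
  ⟨le_rfl, fun _ _ _ _ => .rfl, fun _ _ => .rfl⟩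

theorem Frame.trans {T₁ T₂ T₃ : (⊤ : SimpleGraph ℕ).Subgraph} {L₁ L₂ L₃ : Set ℕ}
    (h : Frame T₁ L₁ T₂ L₂) (h' : Frame T₂ L₂ T₃ L₃) : Frame T₁ L₁ T₃ L₃ where
  le := h.le.trans h'.le
  adj u hu huL w := by
    rw [h'.adj u (h.le.1 hu) (by rwa [h.mem_iff u hu]), h.adj u hu huL]
  mem_iff u hu := by rw [h'.mem_iff u (h.le.1 hu), h.mem_iff u hu]

theorem Frame.enlarge {T T' : (⊤ : SimpleGraph ℕ).Subgraph} {K K' L : Set ℕ}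
    (h : Frame T K T' K') (hK : K ⊆ L) : Frame T L T' (L \ K ∪ K') where
  le := h.le
  adj u hu huL w := h.adj u hu (fun h => huL (hK h)) w
  mem_iff u hu := by
    have := h.mem_iff u hu
    have := @hK u
    simp only [Set.mem_union, Set.mem_sdiff]; tauto

section Rep

variable {T T' : (⊤ : SimpleGraph ℕ).Subgraph} {t : Tree} {x z : ℕ} {L : Set ℕ}

theorem Rep.root_mem (h : Rep T t x z L) : z ∈ L := by
  rcases t with _ | ⟨k, c⟩
  · exact h.elim
  · obtain ⟨v, Ls, -, h, -⟩ := h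
    exact (h z).2 (.inl rfl)

theorem Rep.adj_parent (h : Rep T t x z L) : T.Adj z x := by
  rcases t with _ | ⟨k, c⟩
  · exact h.elim
  · obtain ⟨v, Ls, h, -⟩ := h
    exact (h x).2 (.inl rfl)

theorem Rep.congr (h : Rep T t x z L) (hT : ∀ u ∈ L, ∀ w, T'.Adj u w ↔ T.Adj u w) :
    Rep T' t x z L := by
  induction t generalizing x z L with
  | nil => exact h
  | node k c ih =>
    obtain ⟨v, Ls, h1, h2, h3, h4, h5⟩ := h
    exact ⟨v, Ls, fun w => by rw [hT z ((h2 z).2 (.inl rfl)), h1], h2, h3, h4, fun i hi =>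
      ih i (h5 i hi) fun u hu => hT u ((h2 u).2 (.inr ⟨i, hi, hu⟩))⟩

theorem Rep.sep (h : Rep T t x z L) (hx : x ∉ L) : Sep T L x := by
  suffices ∀ u ∈ L, u ∈ T.verts ∧ ∀ w, T.Adj u w → w ∈ L ∨ w = x from
    ⟨fun u hu => (this u hu).1, hx, fun u hu => (this u hu).2⟩
  clear hx
  induction t generalizing x z L with
  | nil => exact h.elim
  | node k c ih =>
    have hz := h.adj_parent
    obtain ⟨v, Ls, h1, h2, h3, h4, h5⟩ := h
    intro u hu
    rcases (h2 u).1 hu with rfl | ⟨i, hi, hu⟩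
    · refine ⟨hz.fst_mem, fun w hw => ?_⟩
      rcases (h1 w).1 hw with rfl | ⟨i, hi, rfl⟩
      · exact .inr rfl
      · exact .inl ((h2 _).2 (.inr ⟨i, hi, (h5 i hi).root_mem⟩))
    · refine ⟨(ih i (h5 i hi) u hu).1, fun w hw => .inl ((h2 w).2 ?_)⟩
      rcases (ih i (h5 i hi) u hu).2 w hw with hw | rfl
      · exact .inr ⟨i, hi, hw⟩
      · exact .inl rfl

end Rep

theorem Frame.grow {s : State} {L : Set ℕ} (hs : s.pos ∈ L) :
    Frame s.tree L s.grow.tree (insert s.fresh L) where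
  le := s.le_grow
  adj u hu huL w := by
    rw [State.grow_adj]
    have h1 : u ≠ s.pos := by rintro rfl; exact huL hs
    have h2 := s.fresh_ne hu
    tauto
  mem_iff u hu := by simp [s.fresh_ne hu]

theorem rep_fresh (s : State) : Rep s.grow.tree Tree.leaf s.pos s.fresh {s.fresh} := by
  refine ⟨fun _ => 0, fun _ => ∅, fun w => ?_, by simp, by simp, by simp, by simp⟩
  rw [State.grow_adj]
  have h1 : ¬ s.tree.Adj s.fresh w := fun h => s.fresh_notMem h.fst_mem
  have h2 := s.pos_ne_fresh
  simp [h1, h2.symm]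

theorem Rep.grow {s : State} {k : ℕ} {c : ℕ → Tree} {x : ℕ} {L : Set ℕ}
    (h : Rep s.tree (.node k c) x s.pos L) (hx : x ∉ L) :
    Rep s.grow.tree (.node (k + 1) (Function.update c k Tree.leaf)) x s.pos
      (insert s.fresh L) := by
  have hL := (h.sep hx).subset
  have hf : s.fresh ∉ L := fun h => s.fresh_notMem (hL h)
  obtain ⟨v, Ls, h1, h2, h3, h4, h5⟩ := h
  have hLs : ∀ i < k, Ls i ⊆ L := fun i hi u hu => (h2 u).2 (.inr ⟨i, hi, hu⟩)
  have hz := s.pos_ne_fresh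
  refine ⟨Function.update v k s.fresh, Function.update Ls k {s.fresh}, fun w => ?_, fun u => ?_,
    fun i hi => ?_, fun i hi j hj hij u hu => ?_, fun i hi => ?_⟩
  · rw [State.grow_adj, h1, Nat.exists_lt_succ_right, Function.update_self]
    have : (∃ i < k, w = Function.update v k s.fresh i) ↔ ∃ i < k, w = v i :=
      exists_congr fun i => and_congr_right fun hi => by rw [Function.update_of_ne hi.ne]
    rw [this]
    generalize (∃ i < k, w = v i) = E
    simp only [hz, true_and, false_and, or_false, or_assoc]
  · rw [Set.mem_insert_iff, h2, Nat.exists_lt_succ_right, Function.update_self]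
    have : (∃ i < k, u ∈ Function.update Ls k {s.fresh} i) ↔ ∃ i < k, u ∈ Ls i :=
      exists_congr fun i => and_congr_right fun hi => by rw [Function.update_of_ne hi.ne]
    rw [this, Set.mem_singleton_iff]
    generalize (∃ i < k, u ∈ Ls i) = E
    tauto
  · rcases eq_or_ne i k with rfl | hik
    · simpa using hz
    · rw [Function.update_of_ne hik]; exact h3 i (by omega)
  · rcases eq_or_ne i k with rfl | hik
    · rw [Function.update_of_ne hij.symm]
      rw [Function.update_self, Set.mem_singleton_iff] at hu
      rw [hu]; exact fun h => hf (hLs j (by omega) h)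
    · rw [Function.update_of_ne hik] at hu
      rcases eq_or_ne j k with rfl | hjk
      · rw [Function.update_self, Set.mem_singleton_iff]
        rintro rfl; exact hf (hLs i (by omega) hu)
      · rw [Function.update_of_ne hjk]; exact h4 i (by omega) j (by omega) hij u hu
  · rcases eq_or_ne i k with rfl | hik
    · simpa using rep_fresh s
    · have hi : i < k := by omega
      simp only [Function.update_of_ne hik]
      refine (h5 i hi).congr fun u hu w => ?_
      rw [State.grow_adj]
      have h6 : u ≠ s.pos := by rintro rfl; exact h3 i hi hu
      have h7 : u ≠ s.fresh := by rintro rfl; exact hf (hLs i hi hu)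
      tauto

theorem jumpAvg_le_of_nb {s : State} {x k : ℕ} {v : ℕ → ℕ} {h : State → ℝ} {a : ℝ} {b : ℕ → ℝ}
    (hnb : ∀ w, s.tree.Adj s.pos w ↔ w = x ∨ ∃ i < k, w = v i) (hx : ∀ i < k, x ≠ v i)
    (hv : ∀ i < k, ∀ j < k, i ≠ j → v i ≠ v j) (ha : h (s.goto x) ≤ a)
    (hb : ∀ i < k, h (s.goto (v i)) ≤ b i) :
    s.jumpAvg h ≤ (a + ∑ i ∈ Finset.range k, b i) / (k + 1) := by
  have hinj : Set.InjOn v (Finset.range k) := by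
    intro i hi j hj hij
    by_contra hne
    exact hv i (by simpa using hi) j (by simpa using hj) hne hij
  have hxn : x ∉ (Finset.range k).image v := by
    simp only [Finset.mem_image, Finset.mem_range, not_exists, not_and]
    exact fun i hi h => hx i hi h.symm
  have hs : s.nb = insert x ((Finset.range k).image v) := by
    ext w
    simp only [State.mem_nb, hnb, Finset.mem_insert, Finset.mem_image, Finset.mem_range]
    simp only [eq_comm]
  have hne : s.nb.Nonempty := hs ▸ Finset.insert_nonempty _ _
  rw [State.jumpAvg, if_pos hne, hs, Finset.sum_insert hxn, Finset.card_insert_of_notMem hxn,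
    Finset.sum_image hinj, Finset.card_image_of_injOn hinj, Finset.card_range]
  push_cast
  gcongr with i hi
  exact hb i (Finset.mem_range.1 hi)

variable {p : ℝ}

/-- Induction on `n`, for all subtrees and terminal functions at once. After a jump to a child, `x`
can be hit only through the current vertex, so `hit_le_hit` splits the walk there: one use of the
induction compares the part inside the subtree with an excursion of smaller depth, another compares
the rest with the remaining loop. Each use follows a step of the walk, so truncations that are at
least `n` suffice. -/
theorem hit_le_loop (hp0 : 0 ≤ p) (hp1 : p ≤ 1) (N n h m : ℕ) (hh : n ≤ h) (hm : n ≤ m)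
    (hN : n ≤ N) (s : State) (t : Tree) (x : ℕ) (L : Set ℕ) (g : State → ℝ) (κ : Tree → ℝ)
    (hrep : Rep s.tree t x s.pos L) (hx : x ∉ L) (hg : ∀ s, 0 ≤ g s) (hκ : ∀ t, 0 ≤ κ t)
    (H : ∀ (s' : State) (t' : Tree) (L' : Set ℕ), s'.pos = x → Rep s'.tree t' x s.pos L' →
      Frame s.tree L s'.tree L' → g s' ≤ κ t') :
    hit p x g n s ≤ loop p (excursion p N h) m t κ := by
  induction n generalizing h m s t x L g κ with
  | zero =>
    rw [hit, if_neg (by rintro rfl; exact hx hrep.root_mem)]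
    exact (loop_subMean hp0 hp1 (excursion_subMean hp0 hp1 N h) m t).nonneg κ hκ
  | succ n ih =>
    rw [hit, if_neg (by rintro rfl; exact hx hrep.root_mem)]
    obtain ⟨m, rfl⟩ : ∃ m', m = m' + 1 := ⟨m - 1, by omega⟩
    obtain ⟨h, rfl⟩ : ∃ h', h = h' + 1 := ⟨h - 1, by omega⟩
    rcases t with _ | ⟨k, c⟩
    · exact hrep.elim
    have hLoop := fun t => loop_subMean hp0 hp1 (excursion_subMean hp0 hp1 N (h + 1)) m t
    have jump : ∀ (r : State) (k : ℕ) (c : ℕ → Tree) (K : Set ℕ), r.pos = s.pos →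
        Rep r.tree (.node k c) x r.pos K → x ∉ K → Frame s.tree L r.tree K →
        r.jumpAvg (hit p x g n) ≤ jumpMean (fun k c => κ (.node k c)) (fun k c i =>
          excursion p N (h + 1) (c i) fun t =>
            loop p (excursion p N (h + 1)) m (.node k (Function.update c i t)) κ) k c := by
      intro r k c K hr hrep hx hframe
      have hrep' := hrep
      have hxr : r.tree.Adj r.pos x := hrep.adj_parent
      have hK := (hrep.sep hx).subset
      obtain ⟨v, Ls, h1, h2, h3, h4, h5⟩ := hrep
      have hLs : ∀ i < k, Ls i ⊆ K := fun i hi u hu => (h2 u).2 (.inr ⟨i, hi, hu⟩)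
      refine jumpAvg_le_of_nb h1 (fun i hi => ?_) (fun i hi j hj hij hv => ?_) ?_ fun i hi => ?_
      · rintro rfl; exact hx (hLs i hi (h5 i hi).root_mem)
      · exact h4 i hi j hj hij _ (h5 i hi).root_mem (hv ▸ (h5 j hj).root_mem)
      · rw [hit_of_pos (r.goto_pos hxr)]
        exact H _ _ K (r.goto_pos hxr) (by rw [State.goto_tree, ← hr]; exact hrep')
          (by rwa [State.goto_tree])
      · have hvi : r.tree.Adj r.pos (v i) := (h1 _).2 (.inr ⟨i, hi, rfl⟩)
        have hxi : x ∉ Ls i := fun h => hx (hLs i hi h)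
        have hsep : Sep (r.goto (v i)).tree (Ls i) r.pos := by
          rw [State.goto_tree]; exact (h5 i hi).sep (h3 i hi)
        refine (hit_le_hit hp0 hp1 hg le_rfl hsep ?_ ?_ ?_ hxi).trans ?_
        · rw [r.goto_pos hvi]; exact (h5 i hi).root_mem
        · rw [State.goto_tree]; exact r.pos_mem
        · rw [State.goto_tree]; exact hxr.snd_mem
        refine ih h N (by omega) (by omega) (by omega) (r.goto (v i)) (c i) r.pos (Ls i) _ _ ?_
          (h3 i hi) (hit_nonneg hp0 hp1 hg n) (fun t => (hLoop _).nonneg κ hκ) ?_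
        · rw [State.goto_tree, r.goto_pos hvi]; exact h5 i hi
        intro s₁ t₁ L₁ hs₁ hrep₁ hframe₁
        rw [State.goto_tree] at hframe₁
        rw [r.goto_pos hvi] at hrep₁
        have hframe₂ := hframe₁.enlarge (hLs i hi)
        -- The walker is back at `r.pos`; only the subtree of child `i` has changed, from `Ls i` to
        -- `L₁`. The frame condition keeps the other subtrees and the edges at `r.pos` intact, so
        -- the pieces reassemble into one tree.
        refine ih (h + 1) m (by omega) (by omega) (by omega) s₁ _ x (K \ Ls i ∪ L₁) g κ ?_ ?_ hg hκ
          ?_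
        · refine ⟨v, Function.update Ls i L₁, fun w => ?_, fun u => ?_, fun j hj => ?_,
            fun j hj l hl hjl u hu => ?_, fun j hj => ?_⟩
          · rw [hs₁, hframe₁.adj _ r.pos_mem (h3 i hi), h1]
          · have hU : (∃ j < k, u ∈ Function.update Ls i L₁ j) ↔
                u ∈ L₁ ∨ ∃ j < k, j ≠ i ∧ u ∈ Ls j := by
              constructor
              · rintro ⟨j, hj, hu⟩
                rcases eq_or_ne j i with rfl | hji
                · exact .inl (by simpa using hu)
                · exact .inr ⟨j, hj, hji, by simpa [hji] using hu⟩
              · rintro (hu | ⟨j, hj, hji, hu⟩)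
                · exact ⟨i, hi, by simpa using hu⟩
                · exact ⟨j, hj, by simpa [hji] using hu⟩
            rw [hU, Set.mem_union, Set.mem_sdiff, h2, hs₁]
            constructor
            · rintro (⟨rfl | ⟨j, hj, hu⟩, hui⟩ | hu)
              · exact .inl rfl
              · exact .inr (.inr ⟨j, hj, by rintro rfl; exact hui hu, hu⟩)
              · exact .inr (.inl hu)
            · rintro (rfl | hu | ⟨j, hj, hji, hu⟩)
              · exact .inl ⟨.inl rfl, h3 i hi⟩
              · exact .inr hu
              · exact .inl ⟨.inr ⟨j, hj, hu⟩, h4 j hj i hi hji u hu⟩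
          · rcases eq_or_ne j i with rfl | hji
            · rw [Function.update_self, hs₁, hframe₁.mem_iff _ r.pos_mem]; exact h3 j hj
            · rw [Function.update_of_ne hji, hs₁]; exact h3 j hj
          · rcases eq_or_ne j i with rfl | hji
            · rw [Function.update_of_ne hjl.symm]
              rw [Function.update_self] at hu
              intro hul
              rw [hframe₁.mem_iff u (hK (hLs l hl hul))] at hu
              exact h4 j hj l hl hjl u hu hul
            · rw [Function.update_of_ne hji] at hu
              rcases eq_or_ne l i with rfl | hli
              · rw [Function.update_self, hframe₁.mem_iff u (hK (hLs j hj hu))]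
                exact h4 j hj l hl hjl u hu
              · rw [Function.update_of_ne hli]; exact h4 j hj l hl hjl u hu
          · rw [hs₁]
            rcases eq_or_ne j i with rfl | hji
            · simpa using hrep₁
            · simp only [Function.update_of_ne hji]
              refine (h5 j hj).congr fun u hu => hframe₁.adj u (hK (hLs j hj hu)) ?_
              exact h4 j hj i hi hji u hu
        · rwa [hframe₂.mem_iff x hxr.snd_mem]
        · intro s₂ t₂ L₂ hs₂ hrep₂ hframe₃
          exact H s₂ t₂ L₂ hs₂ (by rwa [hs₁, hr] at hrep₂) (hframe.trans (hframe₂.trans hframe₃))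
    rw [loop, urnStep, State.stepAvg]
    have j1 := jump s k c L rfl hrep hx (Frame.refl _ _)
    have j2 := jump s.grow (k + 1) (Function.update c k Tree.leaf) (insert s.fresh L) rfl
      (hrep.grow hx) (by
        rintro (h | h)
        · exact s.fresh_ne hrep.adj_parent.snd_mem h
        · exact hx h) (Frame.grow hrep.root_mem)
    have := mul_le_mul_of_nonneg_left j1 (sub_nonneg.2 hp1)
    have := mul_le_mul_of_nonneg_left j2 hp0
    linarith

/-- The chance to leave a new leaf through its neighbour is bounded away from `1`. -/
theorem exists_hit_fresh_le {p₀ : ℝ} (hp0 : 0 < p₀) (hp1 : p₀ ≤ 1) :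
    ∃ q : ℝ, 0 < q ∧ q < 1 ∧ ∀ p, p₀ ≤ p → p ≤ 1 → ∀ n (s : State),
      hit p s.pos (fun _ => 1) n (s.grow.goto s.fresh) ≤ q := by
  obtain ⟨q, h1, h2, h3⟩ := exists_excursion_leaf_le hp0 hp1
  refine ⟨q, h1, h2, fun p h4 h5 n s => (h3 p h4 h5 n (n + 1)).trans' ?_⟩
  have hadj : s.grow.tree.Adj s.grow.pos s.fresh := by rw [State.grow_adj]; simp
  refine hit_le_loop (hp0.le.trans h4) h5 n n n n le_rfl le_rfl le_rfl _ _ _ {s.fresh} _ _ ?_ ?_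
    (fun _ => zero_le_one) (fun _ => zero_le_one) fun _ _ _ _ _ _ => le_rfl
  · rw [State.goto_tree, State.goto_pos _ hadj]; exact rep_fresh s
  · exact s.pos_ne_fresh

/-! ### Escape from a neighbour, distances and numbers of visits -/

variable {p : ℝ}

theorem hit_le_mul (hp0 : 0 ≤ p) (hp1 : p ≤ 1) {y v : ℕ} {n : ℕ} {s : State} {L : Set ℕ} {b : ℝ}
    (h : Sep s.tree L v) (hs : s.pos ∈ L) (hv : v ∈ s.tree.verts) (hy : y ∈ s.tree.verts)
    (hyL : y ∉ L)
    (H : ∀ t : State, t.pos = v → s.tree ≤ t.tree → hit p y (fun _ => 1) n t ≤ b) :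
    hit p y (fun _ => 1) n s ≤ b * hit p v (fun _ => 1) n s :=
  (hit_le_hit hp0 hp1 (fun _ => zero_le_one) le_rfl h hs hv hy hyL).trans (hit_le hp0 hp1 n s H)

/-- If the degree is at least 3, a jump to another neighbour than `y` must return and then hit `y`,
which costs two factors of the bound by induction on `n`. If the degree is at most 2, with
probability `p` a leaf is born; it is then entered with probability at least 1/3 and not left again
with probability at least `1 - q`. -/
theorem hit_le_of_adj {p₀ q : ℝ} (hp0 : 0 < p₀) (hp : p₀ ≤ p) (hp1 : p ≤ 1) (hq0 : 0 < q)
    (hq1 : q < 1)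
    (hq : ∀ n (s : State), hit p s.pos (fun _ => 1) n (s.grow.goto s.fresh) ≤ q) (n : ℕ)
    (s : State) (y : ℕ) (hy : s.tree.Adj s.pos y) :
    hit p y (fun _ => 1) n s ≤ 1 - p₀ * (1 - q) / 3 := by
  have hpp : 0 ≤ p := hp0.le.trans hp
  have hle := fun y n s => hit_one_le_one hpp hp1 (y := y) n s
  have hpq : p₀ * (1 - q) ≤ 1 * 1 := mul_le_mul (hp.trans hp1) (by linarith) (by linarith) (by simp)
  have hpq0 : 0 < p₀ * (1 - q) := mul_pos hp0 (by linarith)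
  have hpq' : p₀ * (1 - q) ≤ p * (1 - q) := mul_le_mul_of_nonneg_right hp (by linarith)
  set r := 1 - p₀ * (1 - q) / 3 with hr
  induction n generalizing s y with
  | zero =>
    rw [hit, if_neg hy.ne]; linarith
  | succ n ih =>
    rw [hit, if_neg hy.ne]
    by_cases hD : 3 ≤ s.nb.card
    · have jump : ∀ (s : State), s.tree.Adj s.pos y → 3 ≤ s.nb.card →
          s.jumpAvg (hit p y (fun _ => 1) n) ≤ r := by
        intro s hy hD
        have hyn : y ∈ s.nb := by simpa using hy
        have hsum : ∑ v ∈ s.nb.erase y, hit p y (fun _ => 1) n (s.goto v) ≤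
            (s.nb.erase y).card • (r * r) := by
          refine Finset.sum_le_card_nsmul _ _ _ fun v hv => ?_
          obtain ⟨hvy, hv⟩ := Finset.mem_erase.1 hv
          have hv : s.tree.Adj s.pos v := by simpa using hv
          obtain ⟨L, h1, h2, h3⟩ := exists_sep (s.goto v) (w := v) (v := s.pos)
            (by rw [State.goto_tree]; exact hv.symm)
          have hyL : y ∉ L := by
            refine h3 y (SimpleGraph.Adj.reachable ?_)
            rw [SimpleGraph.deleteEdges_adj, State.goto_tree]
            refine ⟨hy, fun h => ?_⟩
            rcases Sym2.eq_iff.1 h with ⟨h, -⟩ | ⟨-, h⟩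
            · exact hv.ne h
            · exact hvy h.symm
          have hrr : 0 ≤ r := by linarith
          refine (hit_le_mul (b := r) hpp hp1 h1 (by rwa [s.goto_pos hv]) ?_ ?_ hyL ?_).trans
            (mul_le_mul_of_nonneg_left ?_ hrr)
          · rw [State.goto_tree]; exact s.pos_mem
          · rw [State.goto_tree]; exact hy.snd_mem
          · intro t ht hst
            rw [State.goto_tree] at hst
            exact ih t y (by rw [ht]; exact hst.2 hy)
          · exact ih _ _ (by rw [State.goto_tree, s.goto_pos hv]; exact hv.symm)
        rw [Finset.card_erase_of_mem hyn, nsmul_eq_mul, Nat.cast_sub (by omega)] at hsum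
        have hD' : (3 : ℝ) ≤ s.nb.card := by exact_mod_cast hD
        rw [State.jumpAvg, if_pos ⟨y, hyn⟩, ← Finset.add_sum_erase _ _ hyn,
          div_le_iff₀ (by linarith)]
        have := hle y n (s.goto y)
        push_cast at hsum
        -- Divided by `1 - r > 0` this reads `1 + r ≤ D * r` for the degree `D`, which holds since
        -- `D ≥ 3` and `r ≥ 1 / 2`.
        have h1 : 1 - r ^ 2 ≤ s.nb.card * (r - r ^ 2) := by
          have : 3 * (r - r ^ 2) ≤ s.nb.card * (r - r ^ 2) :=
            mul_le_mul_of_nonneg_right hD' (by nlinarith)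
          nlinarith
        nlinarith
      refine le_trans ?_ (le_of_eq (show p * r + (1 - p) * r = r by ring))
      have j1 := jump s hy hD
      have j2 := jump s.grow (s.le_grow.2 hy) (by
        rw [State.nb_grow, Finset.card_insert_of_notMem s.fresh_notMem_nb]; omega)
      have : 0 ≤ 1 - p := by linarith
      unfold State.stepAvg; gcongr
    · have j1 : s.jumpAvg (hit p y (fun _ => 1) n) ≤ 1 :=
        (s.jumpAvg_mono fun t _ => hle y n t).trans s.jumpAvg_one.le
      have j2 : s.grow.jumpAvg (hit p y (fun _ => 1) n) ≤ 1 - (1 - q) / 3 := by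
        have hadj : s.grow.tree.Adj s.grow.pos s.fresh := by rw [State.grow_adj]; simp
        have h1 : hit p y (fun _ => 1) n (s.grow.goto s.fresh) ≤ q := by
          refine (hit_le_mul (b := 1) hpp hp1 (L := {s.fresh}) (v := s.pos) ?_ ?_ ?_ ?_ ?_
            fun t _ _ => hle y n t).trans ?_
          · rw [State.goto_tree]
            exact (rep_fresh s).sep s.pos_ne_fresh
          · rw [State.goto_pos _ hadj]; rfl
          · rw [State.goto_tree]; exact s.le_grow.1 s.pos_mem
          · rw [State.goto_tree]; exact s.le_grow.1 hy.snd_mem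
          · exact s.fresh_ne hy.snd_mem
          · rw [one_mul]; exact hq n s
        have h2 := Finset.sum_le_card_nsmul s.nb
          (fun v => hit p y (fun _ => 1) n (s.grow.goto v)) 1 fun v _ => hle y n _
        rw [nsmul_eq_mul, mul_one] at h2
        have hD' : (s.nb.card : ℝ) ≤ 2 := by exact_mod_cast (by omega : s.nb.card ≤ 2)
        rw [State.jumpAvg, if_pos (by rw [State.nb_grow]; exact Finset.insert_nonempty _ _),
          State.nb_grow, Finset.sum_insert s.fresh_notMem_nb,
          Finset.card_insert_of_notMem s.fresh_notMem_nb, div_le_iff₀ (by positivity)]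
        push_cast
        nlinarith
      have := mul_le_mul_of_nonneg_left j2 hpp
      have := mul_le_mul_of_nonneg_left j1 (sub_nonneg.2 hp1)
      unfold State.stepAvg
      nlinarith

/-- The first edge of the path is a bridge, so its far end is reached before `y`. The bound holds in
every larger tree because the path survives growth. -/
theorem hit_le_pow {r : ℝ} (hp0 : 0 ≤ p) (hp1 : p ≤ 1) (hr : 0 ≤ r)
    (h : ∀ n (s : State) (y : ℕ), s.tree.Adj s.pos y → hit p y (fun _ => 1) n s ≤ r) (n : ℕ)
    (s₀ : State) {u y : ℕ} (w : s₀.tree.spanningCoe.Walk u y) (hw : w.IsPath) (s : State)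
    (hs : s₀.tree ≤ s.tree) (hu : s.pos = u) : hit p y (fun _ => 1) n s ≤ r ^ w.length := by
  induction w generalizing s with
  | nil => simpa using hit_one_le_one hp0 hp1 n s
  | @cons u v y huv w ih =>
    rw [SimpleGraph.Walk.cons_isPath_iff] at hw
    have huv' : s.tree.Adj u v := hs.2 huv
    obtain ⟨L, h1, h2, h3⟩ := exists_sep s huv'
    have hreach : (s.tree.spanningCoe.deleteEdges {s(u, v)}).Reachable v y := by
      have h4 : s(u, v) ∉ w.edges := fun h => hw.2 (w.fst_mem_support_of_mem_edges h)
      refine (w.toDeleteEdge _ h4).reachable.mono ?_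
      intro a b hab
      rw [SimpleGraph.deleteEdges_adj] at hab ⊢
      exact ⟨hs.2 hab.1, hab.2⟩
    have hy : y ∈ s.tree.verts := by
      rcases eq_or_ne y v with rfl | hne
      · exact huv'.snd_mem
      · obtain ⟨q⟩ := hreach
        have := q.reverse.adj_snd (SimpleGraph.Walk.not_nil_of_ne hne)
        exact s.tree.edge_vert (SimpleGraph.deleteEdges_adj.1 this).1
    refine (hit_le_mul (b := r ^ w.length) hp0 hp1 h1 (hu ▸ h2) huv'.snd_mem hy (h3 y hreach)
      fun t ht hst => ih hw.1 t (hs.trans hst) ht).trans ?_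
    rw [SimpleGraph.Walk.length_cons, pow_succ]
    exact mul_le_mul_of_nonneg_left (h n s v (hu ▸ huv')) (pow_nonneg hr _)

theorem exists_isPath_dist (s : State) {y : ℕ} (hy : y ∈ s.tree.verts) :
    ∃ w : s.tree.spanningCoe.Walk s.pos y, w.IsPath ∧ w.length = s.dist s.pos y := by
  have h := s.connected.preconnected.coe ⟨s.pos, s.pos_mem⟩ ⟨y, hy⟩
  have h' : s.tree.spanningCoe.Reachable s.pos y :=
    h.map (⟨Subtype.val, id⟩ : s.tree.coe →g s.tree.spanningCoe)
  exact h'.exists_path_of_dist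

/-! ### The tail of the number of visits -/

/-- The probability of at least `k` visits to `y` at the times `0, …, n`. -/
def visitProb (p : ℝ) (y : ℕ) : ℕ → ℕ → State → ℝ
  | _, 0, _ => 1
  | 0, k + 1, s => if s.pos = y ∧ k = 0 then 1 else 0
  | n + 1, k + 1, s =>
    if s.pos = y then s.stepAvg p (visitProb p y n k) else s.stepAvg p (visitProb p y n (k + 1))

theorem visitProb_nonneg (hp0 : 0 ≤ p) (hp1 : p ≤ 1) (y n k : ℕ) (s : State) :
    0 ≤ visitProb p y n k s := by
  induction n generalizing k s with
  | zero =>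
    rcases k with _ | k <;> rw [visitProb]
    · exact zero_le_one
    · split_ifs <;> norm_num
  | succ n ih =>
    rcases k with _ | k <;> rw [visitProb]
    · exact zero_le_one
    · split_ifs <;> exact s.stepAvg_nonneg hp0 hp1 fun t _ => ih _ t

/-- When the tree grows at `y`, the walker certainly has a neighbour to jump to, and from there
returns with probability at most `r`; without growth the trivial bound `1` is used. The first visit
contributes the hitting probability, and each further one a factor `1 - p * (1 - r)`. -/
theorem visitProb_le (hp0 : 0 ≤ p) (hp1 : p ≤ 1) {r : ℝ} (hr0 : 0 ≤ r)
    (h : ∀ n (s : State) (y : ℕ), s.tree.Adj s.pos y → hit p y (fun _ => 1) n s ≤ r) (y n k : ℕ)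
    (s : State) :
    visitProb p y n (k + 1) s ≤ (1 - p * (1 - r)) ^ k * hit p y (fun _ => 1) n s := by
  have hρ : 0 ≤ 1 - p * (1 - r) := by nlinarith
  have away : ∀ k, (∀ n (s : State), s.pos = y →
      visitProb p y n (k + 1) s ≤ (1 - p * (1 - r)) ^ k) → ∀ n (s : State),
      visitProb p y n (k + 1) s ≤ (1 - p * (1 - r)) ^ k * hit p y (fun _ => 1) n s := by
    intro k hk n
    induction n with
    | zero =>
      intro s
      by_cases hs : s.pos = y
      · rw [hit_of_pos hs, mul_one]; exact hk 0 s hs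
      · rw [visitProb, if_neg (by tauto)]
        exact mul_nonneg (pow_nonneg hρ k) (hit_nonneg hp0 hp1 (fun _ => zero_le_one) 0 s)
    | succ n ih =>
      intro s
      by_cases hs : s.pos = y
      · rw [hit_of_pos hs, mul_one]; exact hk _ s hs
      · rw [visitProb, if_neg hs, hit, if_neg hs, ← State.stepAvg_smul]
        exact s.stepAvg_mono hp0 hp1 fun t _ => ih t
  refine away k (fun n s hs => ?_) n s
  induction k generalizing n s with
  | zero =>
    rw [pow_zero]
    have one : ∀ n k s, visitProb p y n k s ≤ 1 := by
      intro n
      induction n with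
      | zero =>
        intro k s
        rcases k with _ | k <;> rw [visitProb]
        split_ifs <;> norm_num
      | succ n ih =>
        intro k s
        rcases k with _ | k <;> rw [visitProb]
        split_ifs <;> exact s.stepAvg_le hp0 hp1 fun t _ => ih _ t
    exact one n 1 s
  | succ k ih =>
    rcases n with _ | n
    · rw [visitProb, if_neg (by simp)]; exact pow_nonneg hρ _
    rw [visitProb, if_pos hs]
    refine (s.stepAvg_mono hp0 hp1 fun t _ => away k (fun n s hs => ih n s hs) n t).trans ?_
    rw [State.stepAvg_smul, pow_succ]
    refine mul_le_mul_of_nonneg_left ?_ (pow_nonneg hρ k)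
    have j1 : s.jumpAvg (hit p y (fun _ => 1) n) ≤ 1 :=
      (s.jumpAvg_mono fun t _ => hit_one_le_one hp0 hp1 n t).trans s.jumpAvg_one.le
    have j2 : s.grow.jumpAvg (hit p y (fun _ => 1) n) ≤ r := by
      have hne : s.grow.nb.Nonempty := by rw [State.nb_grow]; exact Finset.insert_nonempty _ _
      rw [State.jumpAvg, if_pos hne, div_le_iff₀ (by exact_mod_cast hne.card_pos), mul_comm,
        ← nsmul_eq_mul]
      refine Finset.sum_le_card_nsmul _ _ _ fun v hv => h _ _ _ ?_
      have hv : s.grow.tree.Adj s.grow.pos v := by simpa using hv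
      rw [State.goto_tree, State.goto_pos _ hv, ← hs]
      exact hv.symm
    unfold State.stepAvg
    nlinarith

/-! ### The law of the trajectory -/

/-- A process that does not increase in mean at each step does not increase in mean. -/
theorem lintegral_law_le (p : unitInterval) (s : State) (n : ℕ) (φ : ℕ → (ℕ → State) → ENNReal)
    (mφ : ∀ t, Measurable (φ t)) (hdep : DependsOn (φ n) (Set.Iic n))
    (h : ∀ t < n, ∀ ω, ∫⁻ x, φ (t + 1) (Function.update ω (t + 1) x) ∂step p (ω t) ≤ φ t ω) :
    ∫⁻ ω, φ n ω ∂law p s ≤ φ 0 fun _ => s := by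
  set κ : (n : ℕ) → Kernel ((_ : Finset.Iic n) → State) State := fun n =>
    (kernel p).comap (fun h : (_ : Finset.Iic n) → State => h ⟨n, Finset.mem_Iic.2 le_rfl⟩)
      (measurable_pi_apply _) with hκ
  have h1 : ∫⁻ ω, φ n ω ∂law p s =
      Kernel.lmarginalPartialTraj (X := fun _ => State) κ 0 n (φ n) fun _ => s := by
    rw [Kernel.lmarginalPartialTraj, ← Kernel.traj_map_frestrictLe_apply, lintegral_map]
    · refine lintegral_congr fun ω => hdep fun i hi => ?_
      have hi : i ≤ n := hi
      simp [Function.updateFinset, hi]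
    · exact (mφ n).comp measurable_updateFinset
    · fun_prop
  rw [h1]
  have h2 : ∀ t ≤ n, Kernel.lmarginalPartialTraj (X := fun _ => State) κ 0 t (φ t) (fun _ => s) ≤
      φ 0 fun _ => s := by
    intro t ht
    induction t with
    | zero => rw [Kernel.lmarginalPartialTraj_le κ le_rfl (mφ 0)]
    | succ t ih =>
      refine le_trans ?_ (ih (by omega))
      rw [← Kernel.lmarginalPartialTraj_self (Nat.zero_le t) (Nat.le_succ t) (mφ (t + 1))]
      refine Kernel.lmarginalPartialTraj_mono 0 t (fun ω => ?_) _
      rw [Kernel.lmarginalPartialTraj_succ t (mφ (t + 1))]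
      exact h t (by omega) ω
  exact h2 n le_rfl

/-- The number of visits to `y` before time `t`. -/
def visitsBefore (y t : ℕ) (ω : ℕ → State) : ℕ :=
  ∑ i ∈ Finset.range t, if (ω i).pos = y then 1 else 0

theorem measurable_visitsBefore (y t : ℕ) : Measurable (visitsBefore y t) :=
  Finset.measurable_fun_sum _ fun i _ =>
    (measurable_from_top (f := fun s : State => if s.pos = y then 1 else 0)).comp
      (measurable_pi_apply i)

theorem visitsBefore_congr {y t : ℕ} {ω ω' : ℕ → State} (h : ∀ i < t, ω i = ω' i) :
    visitsBefore y t ω = visitsBefore y t ω' :=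
  Finset.sum_congr rfl fun i hi => by rw [h i (Finset.mem_range.1 hi)]

/-- The probability, given the past, that the missing visits occur in the remaining time does not
increase in mean, by the recursion for `visitProb`; at time `n` it equals `1` on the event. -/
theorem law_visitsBefore_le (p : unitInterval) (s : State) (y n k : ℕ) :
    law p s {ω | k ≤ visitsBefore y (n + 1) ω} ≤ ENNReal.ofReal (visitProb p y n k s) := by
  set φ : ℕ → (ℕ → State) → ENNReal := fun t ω =>
    ENNReal.ofReal (visitProb p y (n - t) (k - visitsBefore y t ω) (ω t)) with hφ
  have mφ : ∀ t, Measurable (φ t) := by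
    intro t
    have : Measurable fun x : ℕ × State =>
        ENNReal.ofReal (visitProb p y (n - t) (k - x.1) x.2) :=
      measurable_from_prod_countable_right fun m => measurable_from_top
    exact this.comp ((measurable_visitsBefore y t).prodMk (measurable_pi_apply t))
  have key := lintegral_law_le p s n φ mφ ?_ ?_
  · refine (meas_le_lintegral₀ (mφ n).aemeasurable fun ω hω => ?_).trans
      (key.trans (by simp [hφ, visitsBefore]))
    have hω : k ≤ visitsBefore y (n + 1) ω := hω
    rw [visitsBefore, Finset.sum_range_succ, ← visitsBefore] at hω
    simp only [hφ, Nat.sub_self]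
    rcases hm : k - visitsBefore y n ω with _ | m
    · simp [visitProb]
    · rw [visitProb, if_pos]
      · simp
      · split_ifs at hω with hy
        · exact ⟨hy, by omega⟩
        · omega
  · intro ω ω' h
    have h1 : visitsBefore y n ω = visitsBefore y n ω' :=
      visitsBefore_congr fun i hi => h i (show i ≤ n by omega)
    simp only [hφ, h1, h n (Set.mem_Iic.2 le_rfl)]
  · intro t ht ω
    have h1 : ∀ x, visitsBefore y (t + 1) (Function.update ω (t + 1) x) =
        visitsBefore y t ω + if (ω t).pos = y then 1 else 0 := by
      intro x
      rw [visitsBefore_congr (ω' := ω) fun i hi => Function.update_of_ne (by omega) _ _,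
        visitsBefore, Finset.sum_range_succ, ← visitsBefore]
    simp only [hφ, h1, Function.update_self]
    rw [lintegral_step p (ω t) _ fun x => visitProb_nonneg p.2.1 p.2.2 _ _ _ _]
    refine ENNReal.ofReal_le_ofReal ?_
    obtain ⟨m, hm⟩ : ∃ m, n - t = m + 1 := ⟨n - t - 1, by omega⟩
    rw [show n - (t + 1) = m by omega, hm]
    rcases hj : k - visitsBefore y t ω with _ | j
    · rw [show k - (visitsBefore y t ω + if (ω t).pos = y then 1 else 0) = 0 by omega, visitProb]
      refine (ω t).stepAvg_le p.2.1 p.2.2 fun x _ => ?_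
      cases m <;> simp [visitProb]
    · rw [visitProb]
      split_ifs with hy
      · rw [show k - (visitsBefore y t ω + 1) = j by omega]
      · rw [add_zero, hj]

/-- Any `k` visits occur before some finite time, so the event is covered by an increasing union and
continuity from below applies. -/
theorem law_visits_le (p : unitInterval) (s : State) (y k : ℕ) {b : ℝ}
    (h : ∀ n, visitProb p y n k s ≤ b) : (law p s).real {ω | (k : ℕ∞) ≤ visits y ω} ≤ b := by
  have hb : 0 ≤ b := (visitProb_nonneg p.2.1 p.2.2 y 0 k s).trans (h 0)
  have hsub : {ω | (k : ℕ∞) ≤ visits y ω} ⊆ ⋃ n, {ω | k ≤ visitsBefore y (n + 1) ω} := by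
    intro ω hω
    obtain ⟨S, hS, hk⟩ := Set.exists_subset_encard_eq (show (k : ℕ∞) ≤ visits y ω from hω)
    have hfin : S.Finite := Set.finite_of_encard_eq_coe hk
    obtain ⟨n, hn⟩ := hfin.bddAbove
    refine Set.mem_iUnion.2 ⟨n, ?_⟩
    have hcard : hfin.toFinset.card = k := by
      rw [hfin.encard_eq_coe_toFinset_card] at hk
      exact_mod_cast hk
    rw [Set.mem_ofPred_eq, visitsBefore, ← hcard, Finset.sum_boole, Nat.cast_id]
    refine Finset.card_le_card fun t ht => ?_
    rw [Set.Finite.mem_toFinset] at ht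
    rw [Finset.mem_filter, Finset.mem_range]
    exact ⟨Nat.lt_succ_of_le (hn ht), hS ht⟩
  have hmono : Monotone fun n => {ω | k ≤ visitsBefore y (n + 1) ω} := by
    intro m n hmn ω hω
    refine le_trans (show k ≤ visitsBefore y (m + 1) ω from hω) ?_
    exact Finset.sum_le_sum_of_subset (by simpa using hmn)
  refine ENNReal.toReal_le_of_le_ofReal hb ((measure_mono hsub).trans ?_)
  rw [hmono.measure_iUnion]
  exact iSup_le fun n => (law_visitsBefore_le p s y n k).trans (ENNReal.ofReal_le_ofReal (h n))

end BGRW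

end

/-! ### Choice of the constants -/

theorem mainTheorem7 :
    ∀ p₀ : ℝ, 0 < p₀ → p₀ ≤ 1 →
      ∃ C β : ℝ, 0 < C ∧ 0 < β ∧
        ∀ p : unitInterval, p₀ ≤ (p : ℝ) →
          ∀ s : BGRW.State, ∀ y ∈ s.tree.verts,
            (∀ k : ℕ,
              (BGRW.law p s).real {ω | (k : ℕ∞) ≤ BGRW.visits y ω} ≤ C * Real.exp (-β * k)) ∧
            (BGRW.law p s).real {ω | 0 < BGRW.visits y ω} ≤
              C * Real.exp (-β * s.dist s.pos y) := by
  intro p₀ hp0 hp1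
  obtain ⟨q, hq0, hq1, hq⟩ := BGRW.exists_hit_fresh_le hp0 hp1
  set e := p₀ * (1 - q) / 3 with he
  have he0 : 0 < e := by have := mul_pos hp0 (sub_pos.2 hq1); positivity
  have he1 : e ≤ 1 / 3 := by
    have : p₀ * (1 - q) ≤ 1 * 1 := mul_le_mul hp1 (by linarith) (by linarith) (by simp)
    rw [he]; linarith
  -- This rate dominates both the bound `1 - p * e` on the chance of a further visit and the bound
  -- `1 - e` on the chance of crossing an edge.
  set ρ := 1 - p₀ * e with hρ
  have hpe : 0 < p₀ * e := mul_pos hp0 he0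
  have hpe1 : p₀ * e ≤ 1 * e := mul_le_mul_of_nonneg_right hp1 he0.le
  have hρ0 : 0 < ρ := by linarith
  have hρ1 : ρ < 1 := by linarith
  have hexp : ∀ k : ℕ, Real.exp (-(-Real.log ρ) * k) = ρ ^ k := by
    intro k
    rw [neg_neg, mul_comm, ← Real.log_pow, Real.exp_log (pow_pos hρ0 k)]
  -- The constant `ρ⁻¹` restores the missing factor: `k` visits involve only `k - 1` returns.
  refine ⟨ρ⁻¹, -Real.log ρ, inv_pos.2 hρ0, neg_pos.2 (Real.log_neg hρ0 hρ1),
    fun p hp s y hy => ?_⟩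
  have hadj : ∀ n (s : BGRW.State) (y : ℕ), s.tree.Adj s.pos y →
      BGRW.hit p y (fun _ => 1) n s ≤ 1 - e :=
    BGRW.hit_le_of_adj hp0 hp p.2.2 hq0 hq1 (hq p hp p.2.2)
  have hle : 1 - (p : ℝ) * (1 - (1 - e)) ≤ ρ := by
    have := mul_le_mul_of_nonneg_right hp he0.le
    linarith
  have hle0 : 0 ≤ 1 - (p : ℝ) * (1 - (1 - e)) := by
    have := mul_le_mul_of_nonneg_right p.2.2 he0.le
    linarith
  have hvis := fun n k => BGRW.visitProb_le p.2.1 p.2.2 (r := 1 - e) (by linarith)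
    hadj y n k s
  refine ⟨fun k => BGRW.law_visits_le p s y k fun n => ?_, ?_⟩
  · rw [hexp]
    rcases k with _ | k
    · have := one_le_inv₀ hρ0 |>.2 hρ1.le
      cases n <;> simpa [BGRW.visitProb] using this
    · rw [pow_succ', inv_mul_cancel_left₀ hρ0.ne']
      refine (hvis n k).trans ((mul_le_of_le_one_right (pow_nonneg hle0 k)
        (BGRW.hit_one_le_one p.2.1 p.2.2 n s)).trans ?_)
      gcongr
  · have h1 : {ω | 0 < BGRW.visits y ω} = {ω | ((1 : ℕ) : ℕ∞) ≤ BGRW.visits y ω} := by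
      ext ω
      simp only [Set.mem_ofPred_eq, Nat.cast_one, Order.one_le_iff_ne_zero, pos_iff_ne_zero]
    rw [h1, hexp]
    refine BGRW.law_visits_le p s y 1 fun n => (hvis n 0).trans ?_
    rw [pow_zero, one_mul]
    obtain ⟨w, hw, hlen⟩ := BGRW.exists_isPath_dist s hy
    have h2 := BGRW.hit_le_pow p.2.1 p.2.2 (by linarith : 0 ≤ 1 - e) hadj n s w hw s le_rfl rfl
    rw [hlen] at h2
    calc _ ≤ (1 - e) ^ s.dist s.pos y := h2
      _ ≤ ρ ^ s.dist s.pos y := pow_le_pow_left₀ (by linarith) (by linarith) _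
      _ ≤ ρ⁻¹ * ρ ^ s.dist s.pos y :=
        le_mul_of_one_le_left (by positivity) ((one_le_inv₀ hρ0).2 hρ1.le)
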